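/- Let $N\ge 2$, $0<\ell<N$ and $1\le q<\infty$. Let $\nu$ be a non-negative $\sigma$-finite Borel measure on $\mathbb R^N$, and let $w$ be a weight, i.e. a locally integrable function $w:\mathbb R^N\to\mathbb R$ with $w>0$ almost everywhere. Write $B(x,r)$ for the open ball and $B^c(x,r)$ for its complement, and suppose that for some constants $C_3,C_4>0$ $$\left(\int_{B^{c}(0,2|y|)}\frac{1}{|x|^{(N-\ell+1)q}}\,d\nu(x)\right)^{1/q}\le C_3\,\frac{w(y)}{|y|}\quad\text{and}\quad\left(\int_{B(0,4|y|)}\frac{1}{|x-y|^{(N-\ell)q}}\,d\nu(x)\right)^{1/q}\le C_4\,w(y)$$ for almost every $y\in\mathbb R^N$. Then there exists a constant $C>0$ such that $$\left(\int_{\mathbb R^N}|I_\ell u(x)|^q\,d\nu(x)\right)^{1/q}\le C\,\|Ru\|_{L^1_w}=C\int_{\mathbb R^N}|Ru(x)|\,w(x)\,dx$$ for every (real- or complex-valued) $u\in C_c^\infty(\mathbb R^N)$ with $Ru\in L^1_w$ (if $Ru\notin L^1_w$, the right-hand side is $+\infty$ and the inequality is trivial). Here $$I_\ell u(x)=\frac1{\gamma(\ell)}\int_{\mathbb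 R^N}\frac{u(y)}{|x-y|^{N-\ell}}\,dy,\qquad \gamma(\ell)=\frac{\pi^{N/2}\,2^{\ell}\,\Gamma(\ell/2)}{\Gamma((N-\ell)/2)},$$ is the Riesz potential, and $Ru=(R_1u,\dots,R_Nu)$ is the vector Riesz transform, with $$R_ju(x)=\lim_{\varepsilon\to0^+}\frac{\Gamma(\frac{N+1}2)}{\pi^{(N+1)/2}}\int_{|x-y|>\varepsilon}u(y)\,\frac{x_j-y_j}{|x-y|^{N+1}}\,dy .$$ -/

import Mathlib

open MeasureTheory Filter Topology
open scoped ENNReal NNReal ContDiff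

/-- `ℝ^N` with its Euclidean norm. -/
abbrev RN (N : ℕ) : Type := EuclideanSpace ℝ (Fin N)

/-- A weight on `ℝ^N`: a locally integrable real function which is positive almost everywhere. -/
def IsWeight {N : ℕ} (w : RN N → ℝ) : Prop :=
  LocallyIntegrable w volume ∧ ∀ᵐ x ∂(volume : Measure (RN N)), 0 < w x

/-- The normalizing constant `γ(ℓ) = π^{N/2} 2^ℓ Γ(ℓ/2) / Γ((N-ℓ)/2)`. -/
noncomputable def rieszGamma (N : ℕ) (l : ℝ) : ℝ :=
  Real.pi ^ ((N : ℝ) / 2) * (2 : ℝ) ^ l * Real.Gamma (l / 2) / Real.Gamma (((N : ℝ) - l) / 2)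

/-- The Riesz potential `I_ℓ u(x) = γ(ℓ)⁻¹ ∫ u(y) / |x-y|^{N-ℓ} dy`. -/
noncomputable def rieszPotential {N : ℕ} {𝕜 : Type*} [RCLike 𝕜] (l : ℝ) (u : RN N → 𝕜)
    (x : RN N) : 𝕜 :=
  (1 / rieszGamma N l) • ∫ y, (1 / ‖x - y‖ ^ ((N : ℝ) - l)) • u y

/-- The constant `c_N = Γ((N+1)/2) / π^{(N+1)/2}`. -/
noncomputable def rieszConst (N : ℕ) : ℝ :=
  Real.Gamma (((N : ℝ) + 1) / 2) / Real.pi ^ (((N : ℝ) + 1) / 2)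

/-- The truncated integral `c_N ∫_{|x-y|>ε} u(y) (x_j-y_j) / |x-y|^{N+1} dy`. -/
noncomputable def rieszTruncated {N : ℕ} {𝕜 : Type*} [RCLike 𝕜] (j : Fin N) (u : RN N → 𝕜)
    (x : RN N) (ε : ℝ) : 𝕜 :=
  rieszConst N • ∫ y in {y : RN N | ε < ‖x - y‖}, ((x j - y j) / ‖x - y‖ ^ (N + 1)) • u y

/-- The `j`-th Riesz transform, the principal value `R_j u(x) = lim_{ε → 0⁺}` of the truncated
integrals (the limit exists at every point for smooth compactly supported `u`). -/
noncomputable def rieszTransform {N : ℕ} {𝕜 : Type*} [RCLike 𝕜] (j : Fin N) (u : RN N → 𝕜)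
    (x : RN N) : 𝕜 :=
  limUnder (𝓝[>] (0 : ℝ)) (rieszTruncated j u x)

/-- The vector Riesz transform `Ru = (R_1 u, …, R_N u)`, with values in Euclidean space. -/
noncomputable def rieszVector {N : ℕ} {𝕜 : Type*} [RCLike 𝕜] (u : RN N → 𝕜) (x : RN N) :
    EuclideanSpace 𝕜 (Fin N) :=
  WithLp.toLp 2 fun j => rieszTransform j u x

/-- The weighted norm `‖g‖_{L^1_w} = ∫ |g(x)| w(x) dx`, with value `∞` if the integral diverges. -/
noncomputable def weightedL1Norm {N : ℕ} {V : Type*} [NormedAddCommGroup V] (w : RN N → ℝ)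
    (g : RN N → V) : ℝ≥0∞ :=
  ∫⁻ x, ‖g x‖ₑ * ENNReal.ofReal (w x)

/-- First testing condition: for some constant `C > 0` and almost every `y`,
`(∫_{|x| ≥ 2|y|} |x|^{-(N-ℓ+1)q} dν(x))^{1/q} ≤ C w(y) / |y|`. -/
def OuterTesting {N : ℕ} (l q : ℝ) (ν : Measure (RN N)) (w : RN N → ℝ) : Prop :=
  ∃ C : ℝ, 0 < C ∧ ∀ᵐ y ∂(volume : Measure (RN N)),
    (∫⁻ x in (Metric.ball (0 : RN N) (2 * ‖y‖))ᶜ,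
        1 / ‖x‖ₑ ^ (((N : ℝ) - l + 1) * q) ∂ν) ^ (1 / q)
      ≤ ENNReal.ofReal (C * (w y / ‖y‖))

/-- Second testing condition: for some constant `C > 0` and almost every `y`,
`(∫_{|x| < 4|y|} |x-y|^{-(N-ℓ)q} dν(x))^{1/q} ≤ C w(y)`. The integrand is `∞` at `x = y`. -/
def InnerTesting {N : ℕ} (l q : ℝ) (ν : Measure (RN N)) (w : RN N → ℝ) : Prop :=
  ∃ C : ℝ, 0 < C ∧ ∀ᵐ y ∂(volume : Measure (RN N)),
    (∫⁻ x in Metric.ball (0 : RN N) (4 * ‖y‖),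
        1 / ‖x - y‖ₑ ^ (((N : ℝ) - l) * q) ∂ν) ^ (1 / q)
      ≤ ENNReal.ofReal (C * w y)

/-! Put m = N - ℓ and K_j(z) = z_j |z|^{-m-1}. The potential is recovered from the Riesz transforms:
|·|^{-m} * u is a nonzero multiple of ∑_j K_j * R_j u (`exists_sum_kernel_rieszTransform_eq`). The
bound |K_j(z)| ≤ |z|^{-m} alone is too weak where |y| is small compared with |x|, since there the
outer testing condition controls only the smaller kernel |y| |x|^{-m-1}.

The missing factor |y|/|x| comes from cancellation. Formally Ru is a gradient, hence curl free.
Testing the curl identity for j ≠ k with y_k φ(y), where φ is a radial cutoff at scale ρ, expresses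
∫ φ R_j u through integrals of Ru with weights O(|y|/ρ) (`exists_enorm_integral_radialCutoff_le`); a
second direction k exists because N ≥ 2. Replacing K_j(x - y) by K_j(x - y) - φ(y) K_j(x) with ρ =
|x|/2, and paying for the subtracted term by this cancellation, bounds |I_ℓ u(x)| by a multiple of
the integral of `twoRegionKernel` against |Ru| (`exists_enorm_rieszPotential_le`). Minkowski's
inequality moves the L^q(ν) norm inside that integral, and the two testing conditions bound the
L^q(ν) norm of the kernel in x by a multiple of w(y).

Both facts about Ru are obtained without Fourier analysis. Gamma integrals write the kernels as
superpositions of the Gaussian moments z_j e^{-t|z|²}, for which the sum of convolutions and the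
symmetry of the off-diagonal derivatives are explicit. Oddness allows u(x - z) to be replaced by
`bumpDiff`, which makes the superposition absolutely convergent and yields the decay (1 + |x|)^{-N}
behind the exchanges of integrals. -/

/-! ### Minkowski's integral inequality for Lebesgue integrals -/

section Minkowski

variable {α β : Type*} [MeasurableSpace α] [MeasurableSpace β]

/-- If `g ≤ ∫ f(·, y) dμ(y)` and `∫ g ^ q < ∞`, then `‖g‖_q ≤ ∫ ‖f(·, y)‖_q dμ(y)`. -/
theorem lintegral_rpow_le_of_le_lintegral {ν : Measure α} {μ : Measure β} [SFinite ν] [SFinite μ]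
    {f : α → β → ℝ≥0∞} (hf : Measurable (Function.uncurry f)) {q : ℝ} (hq : 1 < q)
    {g : α → ℝ≥0∞} (hg : Measurable g) (hgf : ∀ x, g x ≤ ∫⁻ y, f x y ∂μ)
    (hfin : ∫⁻ x, g x ^ q ∂ν ≠ ⊤) :
    (∫⁻ x, g x ^ q ∂ν) ^ (1 / q) ≤ ∫⁻ y, (∫⁻ x, f x y ^ q ∂ν) ^ (1 / q) ∂μ := by
  have hq0 : 0 < q := by linarith
  obtain ⟨p, hpq⟩ : ∃ p, q.HolderConjugate p := ⟨_, Real.HolderConjugate.conjExponent hq⟩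
  set I := ∫⁻ x, g x ^ q ∂ν with hI
  by_cases hI0 : I = 0
  · rw [hI0, ENNReal.zero_rpow_of_pos (by positivity)]; exact zero_le
  -- One factor of g^q = g · g^{q-1} is replaced by its bound ∫ f; Tonelli and Hölder then produce
  -- I^{1/p}. Dividing by it requires I to be finite and nonzero.
  have key : I ≤ (∫⁻ y, (∫⁻ x, f x y ^ q ∂ν) ^ (1 / q) ∂μ) * I ^ (1 / p) := by
    calc I ≤ ∫⁻ x, (∫⁻ y, f x y ∂μ) * g x ^ (q - 1) ∂ν := by
          refine lintegral_mono fun x => ?_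
          calc g x ^ q = g x ^ ((1 : ℝ) + (q - 1)) := by ring_nf
            _ = g x * g x ^ (q - 1) := by
              rw [ENNReal.rpow_add_of_nonneg _ _ zero_le_one (by linarith), ENNReal.rpow_one]
            _ ≤ _ := by gcongr; exact hgf x
      _ = ∫⁻ x, ∫⁻ y, f x y * g x ^ (q - 1) ∂μ ∂ν := by
          refine lintegral_congr fun x => ?_
          rw [lintegral_mul_const _ (hf.of_uncurry_left)]
      _ = ∫⁻ y, ∫⁻ x, f x y * g x ^ (q - 1) ∂ν ∂μ := by
          rw [lintegral_lintegral_swap]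
          exact (hf.mul ((hg.comp measurable_fst).pow_const _)).aemeasurable
      _ ≤ ∫⁻ y, (∫⁻ x, f x y ^ q ∂ν) ^ (1 / q) * I ^ (1 / p) ∂μ := by
          refine lintegral_mono fun y => ?_
          refine (ENNReal.lintegral_mul_le_Lp_mul_Lq ν hpq (hf.of_uncurry_right.aemeasurable)
            (hg.pow_const _).aemeasurable).trans_eq ?_
          congr 2
          refine lintegral_congr fun x => ?_
          rw [← ENNReal.rpow_mul, hpq.sub_one_mul_conj]
      _ = _ := by
          rw [lintegral_mul_const]
          exact (hf.pow_const q).lintegral_prod_left'.pow_const _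
  have h1 : I ^ (1 / q) * I ^ (1 / p) = I := by
    rw [← ENNReal.rpow_add _ _ hI0 hfin, one_div, one_div, hpq.inv_add_inv_eq_one,
      ENNReal.rpow_one]
  have h2 : I ^ (1 / p) ≠ 0 := by
    simp [ENNReal.rpow_eq_zero_iff, hI0, hpq.symm.nonneg]
  have h3 : I ^ (1 / p) ≠ ⊤ :=
    ENNReal.rpow_ne_top_of_nonneg (by have := hpq.symm.pos; positivity) hfin
  refine (ENNReal.mul_le_mul_iff_left h2 h3).1 ?_
  rw [h1]; exact key

/-- **Minkowski's integral inequality**. -/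
theorem lintegral_rpow_lintegral_le {ν : Measure α} {μ : Measure β} [SigmaFinite ν] [SFinite μ]
    {f : α → β → ℝ≥0∞} (hf : Measurable (Function.uncurry f)) {q : ℝ} (hq : 1 ≤ q) :
    (∫⁻ x, (∫⁻ y, f x y ∂μ) ^ q ∂ν) ^ (1 / q) ≤ ∫⁻ y, (∫⁻ x, f x y ^ q ∂ν) ^ (1 / q) ∂μ := by
  rcases hq.eq_or_lt with rfl | hq
  · simp only [ENNReal.rpow_one, div_one]
    exact (lintegral_lintegral_swap hf.aemeasurable).le
  have hq0 : 0 < q := by linarith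
  set G : α → ℝ≥0∞ := fun x => ∫⁻ y, f x y ∂μ with hG
  have hGm : Measurable G := hf.lintegral_prod_right'
  let S : ℕ → Set α := spanningSets ν
  have hS : ∀ n, MeasurableSet (S n) := measurableSet_spanningSets ν
  -- Truncation in height and to sets of finite measure makes the q-th moment finite, so that the
  -- division in the previous lemma is legitimate; monotone convergence recovers G.
  let g : ℕ → α → ℝ≥0∞ := fun n => (S n).indicator fun x => min (G x) n
  have hgm : ∀ n, Measurable (g n) := fun n => (hGm.min measurable_const).indicator (hS n)
  have hgG : ∀ n x, g n x ≤ G x := fun n x => by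
    by_cases hx : x ∈ S n <;> simp [g, hx]
  have hmono : Monotone g := by
    intro n k hnk x
    by_cases hx : x ∈ S n
    · have hx' : x ∈ S k := monotone_spanningSets ν hnk hx
      simp only [g, hx, hx', Set.indicator_of_mem]
      exact min_le_min le_rfl (by exact_mod_cast hnk)
    · simp [g, hx]
  have hsup : ∀ x, ⨆ n, g n x = G x := by
    intro x
    refine le_antisymm (iSup_le fun n => hgG n x) ?_
    obtain ⟨n₀, hn₀⟩ : ∃ n, x ∈ S n := by
      have := iUnion_spanningSets ν
      exact Set.mem_iUnion.1 (this ▸ Set.mem_univ x)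
    refine le_of_forall_lt fun c hc => ?_
    obtain ⟨n₁, hn₁⟩ := ENNReal.exists_nat_gt (ne_top_of_lt hc)
    refine lt_of_lt_of_le ?_ (le_iSup (fun n => g n x) (max n₀ n₁))
    have hx' : x ∈ S (max n₀ n₁) := monotone_spanningSets ν (le_max_left _ _) hn₀
    simp only [g, hx', Set.indicator_of_mem]
    refine lt_min hc (hn₁.trans_le ?_)
    exact_mod_cast le_max_right _ _
  have hfin : ∀ n, ∫⁻ x, g n x ^ q ∂ν ≠ ⊤ := by
    intro n
    have : ∫⁻ x, g n x ^ q ∂ν ≤ ∫⁻ x, (S n).indicator (fun _ => (n : ℝ≥0∞) ^ q) x ∂ν := by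
      refine lintegral_mono fun x => ?_
      by_cases hx : x ∈ S n
      · simp only [g, hx, Set.indicator_of_mem]
        gcongr; exact min_le_right _ _
      · simp [g, hx, hq0]
    refine ne_top_of_le_ne_top ?_ this
    rw [lintegral_indicator (hS n), setLIntegral_const]
    exact ENNReal.mul_ne_top (ENNReal.rpow_ne_top_of_nonneg hq0.le (by simp))
      (measure_spanningSets_lt_top ν n).ne
  have h1 : ∫⁻ x, G x ^ q ∂ν = ⨆ n, ∫⁻ x, g n x ^ q ∂ν := by
    rw [← lintegral_iSup (fun n => (hgm n).pow_const q)
      (fun n k hnk x => ENNReal.rpow_le_rpow (hmono hnk x) hq0.le)]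
    refine lintegral_congr fun x => ?_
    rw [← hsup x]
    exact (ENNReal.orderIsoRpow q hq0).map_iSup _
  rw [h1, show (⨆ n, ∫⁻ x, g n x ^ q ∂ν) ^ (1 / q) = ⨆ n, (∫⁻ x, g n x ^ q ∂ν) ^ (1 / q) from
    (ENNReal.orderIsoRpow (1 / q) (by positivity)).map_iSup _]
  exact iSup_le fun n => lintegral_rpow_le_of_le_lintegral hf hq (hgm n) (hgG n) (hfin n)

end Minkowski

/-! ### Gamma integrals -/

section Gamma

theorem integrableOn_rpow_mul_exp_neg_mul {p r : ℝ} (hp : 0 < p) (hr : 0 < r) :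
    IntegrableOn (fun t : ℝ => t ^ (p - 1) * Real.exp (-(r * t))) (Set.Ioi 0) := by
  have := integrableOn_rpow_mul_exp_neg_mul_rpow (s := p - 1) (by linarith) one_pos hr
  simpa using this

end Gamma

/-! ### Gaussian integrals on Euclidean space -/

section Gaussian

variable {N : ℕ}

theorem integrable_norm_pow_mul_exp (hN : 1 ≤ N) (k : ℕ) {c : ℝ} (hc : 0 < c) :
    Integrable (fun v : RN N => ‖v‖ ^ k * Real.exp (-(c * ‖v‖ ^ 2))) := by
  have : Nonempty (Fin N) := ⟨⟨0, hN⟩⟩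
  rw [integrable_fun_norm_addHaar volume (f := fun r => r ^ k * Real.exp (-(c * r ^ 2)))]
  have h := integrableOn_rpow_mul_exp_neg_mul_rpow (s := ((N - 1 + k : ℕ) : ℝ)) (p := 2)
    (lt_of_lt_of_le (by norm_num) (Nat.cast_nonneg _)) two_pos hc
  refine h.congr_fun (fun y hy => ?_) measurableSet_Ioi
  simp only [finrank_euclideanSpace, Fintype.card_fin, smul_eq_mul, Real.rpow_natCast, pow_add,
    Real.rpow_two, neg_mul]
  ring

theorem integral_exp_neg_mul_sq_norm {c : ℝ} (hc : 0 < c) :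
    ∫ v : RN N, Real.exp (-(c * ‖v‖ ^ 2)) = (Real.pi / c) ^ ((N : ℝ) / 2) := by
  have := GaussianFourier.integral_rexp_neg_mul_sq_norm (V := RN N) hc
  simpa using this

/-- In polar coordinates the sphere factor is common to this integral and to the plain Gaussian one,
and the ratio of the radial integrals follows from Γ(N/2 + 1) = (N/2) Γ(N/2). -/
theorem integral_sq_norm_mul_exp_neg (hN : 1 ≤ N) {c : ℝ} (hc : 0 < c) :
    ∫ v : RN N, ‖v‖ ^ 2 * Real.exp (-(c * ‖v‖ ^ 2))
      = (N : ℝ) / (2 * c) * (Real.pi / c) ^ ((N : ℝ) / 2) := by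
  have : Nonempty (Fin N) := ⟨⟨0, hN⟩⟩
  rw [← integral_exp_neg_mul_sq_norm hc,
    integral_fun_norm_addHaar volume (fun r => r ^ 2 * Real.exp (-(c * r ^ 2))),
    integral_fun_norm_addHaar volume (fun r => Real.exp (-(c * r ^ 2)))]
  have hN' : (0 : ℝ) < N := by exact_mod_cast hN
  have h0 := integral_rpow_mul_exp_neg_mul_rpow (p := 2) (q := ((N - 1 : ℕ) : ℝ)) two_pos
    (lt_of_lt_of_le (by norm_num) (Nat.cast_nonneg _)) hc
  have h2 := integral_rpow_mul_exp_neg_mul_rpow (p := 2) (q := ((N + 1 : ℕ) : ℝ)) two_pos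
    (lt_of_lt_of_le (by norm_num) (Nat.cast_nonneg _)) hc
  have e0 : ∫ y in Set.Ioi (0 : ℝ), y ^ (N - 1) • Real.exp (-(c * y ^ 2))
      = c ^ (-(N : ℝ) / 2) * (1 / 2) * Real.Gamma (N / 2) := by
    rw [show -(N : ℝ) / 2 = -(((N - 1 : ℕ) : ℝ) + 1) / 2 by
      rw [Nat.cast_sub hN]; ring, show (N : ℝ) / 2 = (((N - 1 : ℕ) : ℝ) + 1) / 2 by
      rw [Nat.cast_sub hN]; ring, ← h0]
    refine setIntegral_congr_fun measurableSet_Ioi fun y hy => ?_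
    simp
  have e2 : ∫ y in Set.Ioi (0 : ℝ), y ^ (N - 1) • (y ^ 2 * Real.exp (-(c * y ^ 2)))
      = c ^ (-(N : ℝ) / 2) * c⁻¹ * (1 / 2) * (N / 2 * Real.Gamma (N / 2)) := by
    rw [← Real.Gamma_add_one (by positivity), ← Real.rpow_neg_one c, ← Real.rpow_add hc,
      show -(N : ℝ) / 2 + -1 = -(((N + 1 : ℕ) : ℝ) + 1) / 2 by push_cast; ring,
      show (N : ℝ) / 2 + 1 = (((N + 1 : ℕ) : ℝ) + 1) / 2 by push_cast; ring, ← h2]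
    refine setIntegral_congr_fun measurableSet_Ioi fun y hy => ?_
    obtain ⟨n, rfl⟩ : ∃ n, N = n + 1 := ⟨N - 1, by omega⟩
    simp only [Real.rpow_natCast, smul_eq_mul, Real.rpow_two, neg_mul, Nat.add_sub_cancel]
    ring
  simp only [finrank_euclideanSpace, Fintype.card_fin]
  rw [e0, e2]
  simp only [nsmul_eq_mul, smul_eq_mul]
  field_simp

/-- An odd function has integral zero. -/
theorem integral_eq_zero_of_neg {E F : Type*} [NormedAddCommGroup E] [NormedSpace ℝ E]
    [MeasurableSpace E] [MeasurableNeg E] {μ : Measure E} [μ.IsNegInvariant]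
    [NormedAddCommGroup F] [NormedSpace ℝ F] {f : E → F}
    (hf : ∀ x, f (-x) = -f x) : ∫ x, f x ∂μ = 0 := by
  have h := integral_neg_eq_self f μ
  simp only [hf, integral_neg] at h
  have h2 : (2 : ℝ) • ∫ x, f x ∂μ = 0 := by
    rw [two_smul]; nth_rewrite 1 [← h]; simp
  simpa using h2


/-- Completing the square: with y = v + a z and a = t/(s + t), the exponent splits into a part in
|v|² and a part in |z|². The inner product becomes a(1 - a)|z|² - |v|² plus a term linear in v,
which is odd and integrates to zero. -/
theorem integral_inner_mul_exp_mul_exp (hN : 1 ≤ N) {s t : ℝ} (hs : 0 < s) (ht : 0 < t)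
    (z : RN N) :
    ∫ y : RN N, inner ℝ y (z - y) * (Real.exp (-(s * ‖y‖ ^ 2)) * Real.exp (-(t * ‖z - y‖ ^ 2)))
      = Real.pi ^ ((N : ℝ) / 2) * (s + t) ^ (-((N : ℝ) / 2) - 1)
        * (Real.exp (-(s * t / (s + t) * ‖z‖ ^ 2)) * (s * t / (s + t) * ‖z‖ ^ 2 - N / 2)) := by
  have hst : 0 < s + t := by positivity
  set a := t / (s + t) with ha
  set E := Real.exp (-(s * t / (s + t) * ‖z‖ ^ 2)) with hE
  have hpt : ∀ v : RN N, inner ℝ (v + a • z) (z - (v + a • z)) *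
      (Real.exp (-(s * ‖v + a • z‖ ^ 2)) * Real.exp (-(t * ‖z - (v + a • z)‖ ^ 2)))
      = E * (s * t / (s + t) ^ 2 * ‖z‖ ^ 2) * Real.exp (-((s + t) * ‖v‖ ^ 2))
        - E * (‖v‖ ^ 2 * Real.exp (-((s + t) * ‖v‖ ^ 2)))
        + E * (1 - 2 * a) * (inner ℝ v z * Real.exp (-((s + t) * ‖v‖ ^ 2))) := by
    intro v
    have e1 : ‖v + a • z‖ ^ 2 = ‖v‖ ^ 2 + 2 * a * inner ℝ v z + a ^ 2 * ‖z‖ ^ 2 := by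
      rw [norm_add_sq_real, inner_smul_right, norm_smul, mul_pow, Real.norm_eq_abs, sq_abs]; ring
    have e3 : z - (v + a • z) = (1 - a) • z - v := by module
    have e2 : ‖z - (v + a • z)‖ ^ 2
        = ‖v‖ ^ 2 - 2 * (1 - a) * inner ℝ v z + (1 - a) ^ 2 * ‖z‖ ^ 2 := by
      rw [e3, norm_sub_sq_real, inner_smul_left, norm_smul, mul_pow, Real.norm_eq_abs, sq_abs,
        real_inner_comm]
      simp; ring
    have e4 : inner ℝ (v + a • z) (z - (v + a • z))
        = (1 - 2 * a) * inner ℝ v z + a * (1 - a) * ‖z‖ ^ 2 - ‖v‖ ^ 2 := by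
      rw [e3, inner_sub_right, inner_add_left, inner_add_left, inner_smul_right,
        inner_smul_right, inner_smul_left, inner_smul_left, real_inner_self_eq_norm_sq,
        real_inner_self_eq_norm_sq, real_inner_comm v z]
      simp; ring
    rw [e4, e1, e2, ← Real.exp_add, show -(s * (‖v‖ ^ 2 + 2 * a * inner ℝ v z + a ^ 2 * ‖z‖ ^ 2)) +
      -(t * (‖v‖ ^ 2 - 2 * (1 - a) * inner ℝ v z + (1 - a) ^ 2 * ‖z‖ ^ 2))
      = -(s * t / (s + t) * ‖z‖ ^ 2) + -((s + t) * ‖v‖ ^ 2) by rw [ha]; field_simp; ring,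
      Real.exp_add, show s * t / (s + t) ^ 2 = a * (1 - a) by rw [ha]; field_simp; ring]
    ring
  rw [← integral_add_right_eq_self _ (a • z)]
  simp_rw [hpt]
  have i1 := integrable_norm_pow_mul_exp hN 0 hst
  have i2 := integrable_norm_pow_mul_exp hN 2 hst
  have i3 : Integrable (fun v : RN N => inner ℝ v z * Real.exp (-((s + t) * ‖v‖ ^ 2))) := by
    refine ((integrable_norm_pow_mul_exp hN 1 hst).const_mul ‖z‖).mono'
      (by fun_prop) (ae_of_all _ fun v => ?_)
    rw [norm_mul, Real.norm_eq_abs, Real.norm_eq_abs, Real.abs_exp, ← mul_assoc, pow_one]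
    gcongr
    rw [mul_comm]; exact abs_real_inner_le_norm v z
  simp only [pow_zero, one_mul] at i1
  have i4 : Integrable fun v : RN N =>
      E * (s * t / (s + t) ^ 2 * ‖z‖ ^ 2) * Real.exp (-((s + t) * ‖v‖ ^ 2))
        - E * (‖v‖ ^ 2 * Real.exp (-((s + t) * ‖v‖ ^ 2))) :=
    (i1.const_mul _).sub (i2.const_mul _)
  rw [integral_add i4 (i3.const_mul _), integral_sub (i1.const_mul _) (i2.const_mul _),
    integral_const_mul, integral_const_mul,
    integral_const_mul, integral_exp_neg_mul_sq_norm hst, integral_sq_norm_mul_exp_neg hN hst,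
    integral_eq_zero_of_neg (f := fun v : RN N => inner ℝ v z * Real.exp (-((s + t) * ‖v‖ ^ 2)))
      (fun v => by simp), Real.div_rpow Real.pi_pos.le hst.le, Real.rpow_sub_one hst.ne',
    Real.rpow_neg hst.le]
  have := (Real.rpow_pos_of_pos hst ((N : ℝ) / 2)).ne'
  field_simp
  ring

end Gaussian

/-! ### Integrability of |z|^{-m} against decay of order N -/

section Decay

variable {N : ℕ}

theorem integrableOn_ball_norm_rpow (hN : 1 ≤ N) {m : ℝ} (hm : m < N) :
    IntegrableOn (fun z : RN N => ‖z‖ ^ (-m)) (Metric.ball 0 1) := by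
  have : Nonempty (Fin N) := ⟨⟨0, hN⟩⟩
  rw [integrableOn_fun_norm_addHaar volume (f := fun r => r ^ (-m))]
  have h := (intervalIntegral.integrableOn_Ioo_rpow_iff (s := (N : ℝ) - 1 - m) one_pos).2
    (by linarith)
  refine h.congr_fun (fun y hy => ?_) measurableSet_Ioo
  simp only [finrank_euclideanSpace, Fintype.card_fin, smul_eq_mul]
  rw [← Real.rpow_natCast, ← Real.rpow_add hy.1, Nat.cast_sub hN]
  simp [sub_eq_add_neg]

/-- Near the origin m < N suffices. Off the unit ball both factors are comparable to powers of 1 +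
|z|, with total decay N + m > N. This makes the convolutions K_j * R_j u converge absolutely. -/
theorem integrable_norm_rpow_mul_decay (hN : 1 ≤ N) {m : ℝ} (hm0 : 0 < m) (hm : m < N)
    (x : RN N) :
    Integrable (fun z : RN N => ‖z‖ ^ (-m) * (1 + ‖x - z‖) ^ (-(N : ℝ))) := by
  have h1 : Integrable ((Metric.ball (0 : RN N) 1).indicator fun z => ‖z‖ ^ (-m)) :=
    (integrable_indicator_iff measurableSet_ball).2 (integrableOn_ball_norm_rpow hN hm)
  have h2 : Integrable fun z : RN N => (1 + ‖z‖) ^ (-((N : ℝ) + m)) :=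
    integrable_one_add_norm (by simp [hm0])
  refine (h1.add (h2.const_mul (2 ^ m * (1 + ‖x‖) ^ (N : ℝ)))).mono'
    (Measurable.aestronglyMeasurable (by fun_prop)) (ae_of_all _ fun z => ?_)
  rw [Real.norm_of_nonneg (by positivity)]
  by_cases hz : z ∈ Metric.ball (0 : RN N) 1
  · simp only [Pi.add_apply, hz, Set.indicator_of_mem]
    have : (1 + ‖x - z‖) ^ (-(N : ℝ)) ≤ 1 :=
      Real.rpow_le_one_of_one_le_of_nonpos (by linarith [norm_nonneg (x - z)]) (by simp)
    have h3 : 0 ≤ 2 ^ m * (1 + ‖x‖) ^ (N : ℝ) * (1 + ‖z‖) ^ (-((N : ℝ) + m)) := by positivity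
    have h4 : (0 : ℝ) ≤ ‖z‖ ^ (-m) := by positivity
    nlinarith
  · simp only [Pi.add_apply, hz, not_false_eq_true, Set.indicator_of_notMem, zero_add]
    have hz1 : 1 ≤ ‖z‖ := by simpa using hz
    have hz0 : 0 < ‖z‖ := by linarith
    have a1 : ‖z‖ ^ (-m) ≤ 2 ^ m * (1 + ‖z‖) ^ (-m) := by
      rw [Real.rpow_neg (by positivity), Real.rpow_neg (by positivity), ← div_eq_mul_inv,
        ← Real.div_rpow (by positivity) (by positivity), ← Real.inv_rpow (by positivity)]
      refine Real.rpow_le_rpow (by positivity) ?_ hm0.le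
      rw [inv_eq_one_div, div_le_div_iff₀ (by positivity) (by positivity)]
      linarith
    have a2 : (1 + ‖x - z‖) ^ (-(N : ℝ)) ≤ (1 + ‖x‖) ^ (N : ℝ) * (1 + ‖z‖) ^ (-(N : ℝ)) := by
      rw [Real.rpow_neg (by positivity), Real.rpow_neg (by positivity), ← div_eq_mul_inv,
        ← Real.div_rpow (by positivity) (by positivity), ← Real.inv_rpow (by positivity)]
      refine Real.rpow_le_rpow (by positivity) ?_ (by positivity)
      rw [inv_eq_one_div, div_le_div_iff₀ (by positivity) (by positivity)]
      have : ‖z‖ ≤ ‖x‖ + ‖x - z‖ := by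
        have := norm_sub_le x (x - z); simpa using this
      nlinarith [norm_nonneg x, norm_nonneg (x - z)]
    calc _ ≤ (2 ^ m * (1 + ‖z‖) ^ (-m)) * ((1 + ‖x‖) ^ (N : ℝ) * (1 + ‖z‖) ^ (-(N : ℝ))) := by
          gcongr
      _ = _ := by
          rw [show -((N : ℝ) + m) = -m + -(N : ℝ) by ring, Real.rpow_add (by positivity)]; ring

end Decay

/-! ### Gaussian subordination and decay of the Riesz transforms -/

section RieszTransform

variable {N : ℕ} {𝕜 : Type*} [RCLike 𝕜]

/-- The Gaussian moment `z_j e^{-t|z|²}`. -/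
noncomputable def gaussMoment (j : Fin N) (t : ℝ) (z : RN N) : ℝ :=
  z j * Real.exp (-(t * ‖z‖ ^ 2))

/-- The convolution of `u` with the Gaussian moment `z_j e^{-t|z|²}`. -/
noncomputable def gaussRiesz (j : Fin N) (u : RN N → 𝕜) (t : ℝ) (x : RN N) : 𝕜 :=
  ∫ z, gaussMoment j t z • u (x - z)

/-- The regularized difference `u(x - z) - 1_{|z| < 1} u(x)`. -/
noncomputable def bumpDiff (u : RN N → 𝕜) (x z : RN N) : 𝕜 :=
  u (x - z) - (Metric.ball (0 : RN N) 1).indicator (fun _ => u x) z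

/-- The majorant `∫ |z|^{-N} |u(x - z) - 1_{|z| < 1} u(x)| dz` of the Riesz transforms. -/
noncomputable def rieszMajorant (u : RN N → 𝕜) (x : RN N) : ℝ :=
  ∫ z, ‖z‖ ^ (-(N : ℝ)) * ‖bumpDiff u x z‖

theorem abs_coord_le_norm (z : RN N) (j : Fin N) : |z j| ≤ ‖z‖ := by
  simpa using EuclideanSpace.norm_eq z ▸ PiLp.norm_apply_le z j

theorem abs_coord_mul_rpow_neg_add_one_le (j : Fin N) (z : RN N) (p : ℝ) :
    |z j| * ‖z‖ ^ (-(p + 1)) ≤ ‖z‖ ^ (-p) := by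
  rcases eq_or_ne z 0 with rfl | hz
  · simp only [PiLp.zero_apply, abs_zero, zero_mul]; positivity
  · calc _ ≤ ‖z‖ * ‖z‖ ^ (-(p + 1)) := by gcongr; exact abs_coord_le_norm z j
      _ = _ := by
        nth_rewrite 1 [← Real.rpow_one ‖z‖]
        rw [← Real.rpow_add (by positivity)]; congr 1; ring

theorem abs_coord_mul_rpow_le (j : Fin N) (z : RN N) :
    |z j| * ‖z‖ ^ (-(2 * (((N : ℝ) + 1) / 2))) ≤ ‖z‖ ^ (-(N : ℝ)) := by
  rw [show 2 * (((N : ℝ) + 1) / 2) = N + 1 by ring]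
  exact abs_coord_mul_rpow_neg_add_one_le j z N

theorem continuous_gaussMoment (j : Fin N) :
    Continuous fun p : ℝ × RN N => gaussMoment j p.1 p.2 := by
  unfold gaussMoment; fun_prop

theorem norm_gaussMoment_le (j : Fin N) (t : ℝ) (z : RN N) :
    ‖gaussMoment j t z‖ ≤ ‖z‖ * Real.exp (-(t * ‖z‖ ^ 2)) := by
  rw [gaussMoment, norm_mul, Real.norm_eq_abs, Real.norm_eq_abs, Real.abs_exp]
  gcongr; exact abs_coord_le_norm z j

theorem integrable_gaussMoment (hN : 1 ≤ N) (j : Fin N) {t : ℝ} (ht : 0 < t) :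
    Integrable (gaussMoment j t : RN N → ℝ) := by
  refine (integrable_norm_pow_mul_exp hN 1 ht).mono'
    (by unfold gaussMoment; fun_prop) (ae_of_all _ fun z => ?_)
  simpa using norm_gaussMoment_le j t z

theorem gaussMoment_neg (j : Fin N) (t : ℝ) (z : RN N) :
    gaussMoment j t (-z) = -gaussMoment j t z := by
  simp [gaussMoment]

theorem integrableOn_rpow_mul_gaussMoment (j : Fin N) {p : ℝ} (hp : 0 < p) (z : RN N) :
    IntegrableOn (fun t : ℝ => t ^ (p - 1) * gaussMoment j t z) (Set.Ioi 0) := by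
  rcases eq_or_ne z 0 with rfl | hz
  · simp [gaussMoment]
  · have := (integrableOn_rpow_mul_exp_neg_mul hp (r := ‖z‖ ^ 2) (by positivity)).const_mul (z j)
    refine IntegrableOn.congr_fun this (fun t _ => ?_) measurableSet_Ioi
    simp only [gaussMoment]; rw [mul_comm t]; ring

/-- The subordination formula: p = (N + 1)/2 gives the Riesz kernel and p = (m + 1)/2 gives K_j. The
factor z_j makes it hold at z = 0 as well. -/
theorem setIntegral_rpow_mul_gaussMoment (j : Fin N) {p : ℝ} (hp : 0 < p) (z : RN N) :
    ∫ t in Set.Ioi (0 : ℝ), t ^ (p - 1) * gaussMoment j t z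
      = Real.Gamma p * (z j * ‖z‖ ^ (-(2 * p))) := by
  rcases eq_or_ne z 0 with rfl | hz
  · simp [gaussMoment]
  · have h := Real.integral_rpow_mul_exp_neg_mul_Ioi hp (r := ‖z‖ ^ 2) (by positivity)
    have : ∀ t : ℝ, t ^ (p - 1) * gaussMoment j t z
        = z j * (t ^ (p - 1) * Real.exp (-(‖z‖ ^ 2 * t))) := fun t => by
      simp only [gaussMoment]; rw [mul_comm t]; ring
    simp_rw [this]
    rw [integral_const_mul, h, Real.div_rpow zero_le_one (by positivity), Real.one_rpow,
      ← Real.rpow_two, ← Real.rpow_mul (norm_nonneg z), Real.rpow_neg (norm_nonneg z)]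
    ring

theorem setIntegral_norm_rpow_mul_gaussMoment (j : Fin N) {p : ℝ} (hp : 0 < p) (z : RN N) :
    ∫ t in Set.Ioi (0 : ℝ), ‖t ^ (p - 1) * gaussMoment j t z‖
      = Real.Gamma p * (|z j| * ‖z‖ ^ (-(2 * p))) := by
  rcases eq_or_ne z 0 with rfl | hz
  · simp [gaussMoment]
  · have h := Real.integral_rpow_mul_exp_neg_mul_Ioi hp (r := ‖z‖ ^ 2) (by positivity)
    have h1 : ∫ t in Set.Ioi (0 : ℝ), ‖t ^ (p - 1) * gaussMoment j t z‖
        = ∫ t in Set.Ioi (0 : ℝ), |z j| * (t ^ (p - 1) * Real.exp (-(‖z‖ ^ 2 * t))) := by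
      refine setIntegral_congr_fun measurableSet_Ioi fun t ht => ?_
      have : 0 ≤ t ^ (p - 1) := Real.rpow_nonneg (le_of_lt ht) _
      simp only [gaussMoment, norm_mul, Real.norm_eq_abs, Real.abs_exp, abs_of_nonneg this]
      rw [mul_comm t]; ring
    rw [h1, integral_const_mul, h, Real.div_rpow zero_le_one (by positivity), Real.one_rpow,
      ← Real.rpow_two, ← Real.rpow_mul (norm_nonneg z), Real.rpow_neg (norm_nonneg z)]
    ring

/-- Standing assumptions: `u` is Lipschitz with compact support. -/
structure LipCompact (u : RN N → 𝕜) : Prop where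
  lip : ∃ K : ℝ≥0, LipschitzWith K u
  supp : HasCompactSupport u

namespace LipCompact

variable {u : RN N → 𝕜}

theorem of_contDiff (hu : ContDiff ℝ ∞ u) (hc : HasCompactSupport u) : LipCompact u :=
  ⟨ContDiff.lipschitzWith_of_hasCompactSupport hc hu (by simp), hc⟩

theorem continuous (h : LipCompact u) : Continuous u := h.lip.choose_spec.continuous

theorem integrable (h : LipCompact u) : Integrable u :=
  h.continuous.integrable_of_hasCompactSupport h.supp

theorem exists_bound (h : LipCompact u) : ∃ B, ∀ x, ‖u x‖ ≤ B :=
  h.continuous.bounded_above_of_compact_support h.supp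

theorem exists_radius (h : LipCompact u) : ∃ R : ℝ, 1 ≤ R ∧ ∀ x, R < ‖x‖ → u x = 0 := by
  obtain ⟨R, hR⟩ := h.supp.isCompact.isBounded.subset_closedBall (0 : RN N)
  refine ⟨max R 1, le_max_right _ _, fun x hx => ?_⟩
  by_contra hne
  have := hR (subset_tsupport u hne)
  simp only [mem_closedBall_zero_iff] at this
  exact absurd (this.trans (le_max_left R 1)) (not_le.2 hx)

theorem measurable_bumpDiff (h : LipCompact u) :
    Measurable fun p : RN N × RN N => bumpDiff u p.1 p.2 := by
  have hm := h.continuous.measurable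
  have : (fun p : RN N × RN N => bumpDiff u p.1 p.2) = fun p => u (p.1 - p.2) -
      (Prod.snd ⁻¹' Metric.ball (0 : RN N) 1).indicator (fun p : RN N × RN N => u p.1) p := by
    ext p; simp [bumpDiff, Set.indicator]
  rw [this]
  exact (by fun_prop : Measurable fun p : RN N × RN N => u (p.1 - p.2)).sub
    ((by fun_prop : Measurable fun p : RN N × RN N => u p.1).indicator
      (measurable_snd measurableSet_ball))

theorem measurable_bumpDiff_right (h : LipCompact u) (x : RN N) : Measurable (bumpDiff u x) :=
  h.measurable_bumpDiff.comp measurable_prodMk_left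

/-- In the unit ball the Lipschitz bound gains a factor |z| and leaves the integrable singularity
|z|^{1-N}; outside, |z|^{-N} ≤ 1 and only u(x - z) remains. The function g does not depend on x. -/
theorem exists_majorant_bound (hN : 1 ≤ N) (h : LipCompact u) : ∃ g : RN N → ℝ, Integrable g ∧
    ∀ x z, ‖z‖ ^ (-(N : ℝ)) * ‖bumpDiff u x z‖ ≤ g z + ‖u (x - z)‖ := by
  obtain ⟨K, hK⟩ := h.lip
  have h1 : Integrable ((Metric.ball (0 : RN N) 1).indicator fun z => ‖z‖ ^ (-((N : ℝ) - 1))) :=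
    (integrable_indicator_iff measurableSet_ball).2 (integrableOn_ball_norm_rpow hN (by linarith))
  have hN' : (N : ℝ) ≠ 0 := by positivity
  refine ⟨_, h1.const_mul K, fun x z => ?_⟩
  by_cases hz : z ∈ Metric.ball (0 : RN N) 1
  · simp only [bumpDiff, hz, Set.indicator_of_mem]
    rcases eq_or_ne z 0 with rfl | hz0
    · simp only [norm_zero, sub_zero]
      -- Real powers take the value 0 at base 0 when the exponent is nonzero.
      rw [Real.zero_rpow (by simpa using hN'), zero_mul]; positivity
    · have : ‖u (x - z) - u x‖ ≤ K * ‖z‖ := by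
        have := hK.dist_le_mul (x - z) x
        simpa [dist_eq_norm] using this
      calc _ ≤ ‖z‖ ^ (-(N : ℝ)) * (K * ‖z‖) := by gcongr
        _ = K * ‖z‖ ^ (-((N : ℝ) - 1)) := by
          rw [neg_sub, sub_eq_add_neg, Real.rpow_add (by positivity), Real.rpow_one]; ring
        _ ≤ _ := by linarith [norm_nonneg (u (x - z))]
  · simp only [bumpDiff, hz, not_false_eq_true, Set.indicator_of_notMem, mul_zero, zero_add,
      sub_zero]
    have hz1 : 1 ≤ ‖z‖ := by simpa using hz
    exact mul_le_of_le_one_left (norm_nonneg _)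
      (Real.rpow_le_one_of_one_le_of_nonpos hz1 (by simp))

theorem integrable_majorant (hN : 1 ≤ N) (h : LipCompact u) (x : RN N) :
    Integrable fun z => ‖z‖ ^ (-(N : ℝ)) * ‖bumpDiff u x z‖ := by
  obtain ⟨g, hg, hgu⟩ := h.exists_majorant_bound hN
  refine (hg.add (h.integrable.comp_sub_left x).norm).mono' ?_ (ae_of_all _ fun z => ?_)
  · exact (Measurable.mul (by fun_prop)
      (h.measurable_bumpDiff_right x).norm).aestronglyMeasurable
  · rw [Real.norm_of_nonneg (by positivity)]; exact hgu x z

/-- Let u vanish for |x| > R. If |x| > 2R, the subtracted u(x) is zero and only z with |x - z| ≤ R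
contribute; these satisfy |z| ≥ (1 + |x|)/4 because R ≥ 1. For |x| ≤ 2R a uniform bound is enough.
-/
theorem exists_rieszMajorant_le (hN : 1 ≤ N) (h : LipCompact u) :
    ∃ C : ℝ, 0 ≤ C ∧ ∀ x, rieszMajorant u x ≤ C * (1 + ‖x‖) ^ (-(N : ℝ)) := by
  obtain ⟨g, hg, hgu⟩ := h.exists_majorant_bound hN
  obtain ⟨R, hR1, hR⟩ := h.exists_radius
  set U := ∫ z, ‖u z‖ with hU
  have hU0 : 0 ≤ U := integral_nonneg fun _ => norm_nonneg _
  have hUx : ∀ x, ∫ z, ‖u (x - z)‖ = U := fun x =>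
    integral_sub_left_eq_self (fun z => ‖u z‖) volume x
  set G := ∫ z, |g z| with hG
  have hG0 : 0 ≤ G := integral_nonneg fun _ => abs_nonneg _
  have hb : ∀ x, rieszMajorant u x ≤ G + U := fun x => by
    rw [← hUx x, hG, ← integral_add hg.abs (h.integrable.comp_sub_left x).norm]
    exact integral_mono (h.integrable_majorant hN x)
      (hg.abs.add (h.integrable.comp_sub_left x).norm)
      fun z => (hgu x z).trans (by gcongr; exact le_abs_self _)
  refine ⟨(G + U) * (1 + 2 * R) ^ (N : ℝ) + U * 4 ^ (N : ℝ), by positivity, fun x => ?_⟩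
  have hx1 : 0 < 1 + ‖x‖ := by positivity
  rw [add_mul, Real.rpow_neg hx1.le]
  by_cases hx : ‖x‖ ≤ 2 * R
  · have h1 : 1 ≤ (1 + 2 * R) ^ (N : ℝ) * ((1 + ‖x‖) ^ (N : ℝ))⁻¹ := by
      rw [← div_eq_mul_inv, one_le_div (by positivity)]
      gcongr
    have h2 : 0 ≤ U * 4 ^ (N : ℝ) * ((1 + ‖x‖) ^ (N : ℝ))⁻¹ := by positivity
    have h3 := hb x
    nlinarith
  · push Not at hx
    have hux : u x = 0 := hR x (by linarith)
    have h2 : 0 ≤ (G + U) * (1 + 2 * R) ^ (N : ℝ) * ((1 + ‖x‖) ^ (N : ℝ))⁻¹ := by positivity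
    have h3 : rieszMajorant u x ≤ ∫ z, (4 ^ (N : ℝ) * ((1 + ‖x‖) ^ (N : ℝ))⁻¹) * ‖u (x - z)‖ := by
      refine integral_mono (h.integrable_majorant hN x)
        ((h.integrable.comp_sub_left x).norm.const_mul _) fun z => ?_
      have : bumpDiff u x z = u (x - z) := by simp [bumpDiff, hux]
      simp only [this]
      by_cases hz : u (x - z) = 0
      · simp [hz]
      · have hxz : ‖x - z‖ ≤ R := by
          by_contra hcon; exact hz (hR _ (not_le.1 hcon))
        have hz4 : (1 + ‖x‖) / 4 ≤ ‖z‖ := by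
          have := norm_sub_norm_le x z
          linarith
        gcongr
        rw [Real.rpow_neg (norm_nonneg z), ← div_eq_mul_inv,
          ← Real.div_rpow (by norm_num) (by positivity), ← Real.inv_rpow (by positivity)]
        refine Real.rpow_le_rpow (by positivity) ?_ (by positivity)
        rw [inv_eq_one_div, div_le_div_iff₀ (by linarith) (by positivity)]
        linarith
    rw [integral_const_mul, hUx] at h3
    nlinarith

/-- The Gaussian moment is odd and the indicator of the ball is even, so subtracting u(x) on the
ball changes nothing. The difference is what can be integrated absolutely in t. -/
theorem gaussRiesz_eq (hN : 1 ≤ N) (h : LipCompact u) (j : Fin N) {t : ℝ} (ht : 0 < t)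
    (x : RN N) : gaussRiesz j u t x = ∫ z, gaussMoment j t z • bumpDiff u x z := by
  obtain ⟨B, hB⟩ := h.exists_bound
  have i1 : Integrable fun z => gaussMoment j t z • u (x - z) :=
    (integrable_gaussMoment hN j ht).smul_bdd B
      (h.continuous.comp (by fun_prop)).aestronglyMeasurable (ae_of_all _ fun z => hB _)
  have i2 : Integrable fun z => gaussMoment j t z •
      (Metric.ball (0 : RN N) 1).indicator (fun _ => u x) z := by
    refine (integrable_gaussMoment hN j ht).smul_bdd ‖u x‖
      (measurable_const.indicator measurableSet_ball).aestronglyMeasurable (ae_of_all _ fun z => ?_)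
    exact norm_indicator_le_norm_self (fun _ => u x) z
  simp only [bumpDiff, smul_sub]
  rw [integral_sub i1 i2, integral_eq_zero_of_neg
    (f := fun z => gaussMoment j t z • (Metric.ball (0 : RN N) 1).indicator (fun _ => u x) z),
    sub_zero, gaussRiesz]
  intro z
  rw [gaussMoment_neg, neg_smul]
  congr 2
  simp [Set.indicator]

theorem integrable_rpow_mul_gaussMoment_smul_bumpDiff (hN : 1 ≤ N) (h : LipCompact u) (j : Fin N)
    (x : RN N) : Integrable (fun p : RN N × ℝ =>
      (p.2 ^ (((N : ℝ) + 1) / 2 - 1) * gaussMoment j p.2 p.1) • bumpDiff u x p.1)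
      (volume.prod (volume.restrict (Set.Ioi 0))) ∧
    ∀ z : RN N, ∫ t in Set.Ioi (0 : ℝ),
      ‖(t ^ (((N : ℝ) + 1) / 2 - 1) * gaussMoment j t z) • bumpDiff u x z‖
      ≤ Real.Gamma (((N : ℝ) + 1) / 2) * (‖z‖ ^ (-(N : ℝ)) * ‖bumpDiff u x z‖) := by
  have hp : 0 < ((N : ℝ) + 1) / 2 := by positivity
  have hm : AEStronglyMeasurable (fun p : RN N × ℝ =>
      (p.2 ^ (((N : ℝ) + 1) / 2 - 1) * gaussMoment j p.2 p.1) • bumpDiff u x p.1)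
      (volume.prod (volume.restrict (Set.Ioi 0))) := by
    have hpow : Measurable fun p : RN N × ℝ => p.2 ^ (((N : ℝ) + 1) / 2 - 1) := by fun_prop
    refine Measurable.aestronglyMeasurable (Measurable.smul (hpow.mul ?_) ?_)
    · exact (continuous_gaussMoment j).measurable.comp (measurable_snd.prodMk measurable_fst)
    · exact (h.measurable_bumpDiff_right x).comp measurable_fst
  have hn : ∀ z : RN N, ∫ t in Set.Ioi (0 : ℝ),
      ‖(t ^ (((N : ℝ) + 1) / 2 - 1) * gaussMoment j t z) • bumpDiff u x z‖
      ≤ Real.Gamma (((N : ℝ) + 1) / 2) * (‖z‖ ^ (-(N : ℝ)) * ‖bumpDiff u x z‖) := fun z => by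
    simp_rw [norm_smul (_ * _)]
    rw [integral_mul_const, setIntegral_norm_rpow_mul_gaussMoment j hp, mul_assoc]
    have := (Real.Gamma_pos_of_pos hp).le
    gcongr ?_ * (?_ * _)
    exact abs_coord_mul_rpow_le j z
  refine ⟨(integrable_prod_iff hm).2 ⟨ae_of_all _ fun z => ?_, ?_⟩, hn⟩
  · exact Integrable.smul_const (integrableOn_rpow_mul_gaussMoment j hp z) (bumpDiff u x z)
  · refine ((h.integrable_majorant hN x).const_mul (Real.Gamma (((N : ℝ) + 1) / 2))).mono'
      hm.norm.integral_prod_right' (ae_of_all _ fun z => ?_)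
    rw [Real.norm_of_nonneg (integral_nonneg fun _ => norm_nonneg _)]
    exact hn z

theorem rpow_smul_gaussRiesz_eq (hN : 1 ≤ N) (h : LipCompact u) (j : Fin N) (x : RN N) {t : ℝ}
    (ht : 0 < t) : t ^ (((N : ℝ) + 1) / 2 - 1) • gaussRiesz j u t x
      = ∫ z, (t ^ (((N : ℝ) + 1) / 2 - 1) * gaussMoment j t z) • bumpDiff u x z := by
  rw [h.gaussRiesz_eq hN j ht, ← integral_smul]
  simp only [smul_smul]

theorem integrableOn_rpow_smul_gaussRiesz (hN : 1 ≤ N) (h : LipCompact u) (j : Fin N)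
    (x : RN N) :
    IntegrableOn (fun t : ℝ => t ^ (((N : ℝ) + 1) / 2 - 1) • gaussRiesz j u t x) (Set.Ioi 0) := by
  have := (h.integrable_rpow_mul_gaussMoment_smul_bumpDiff hN j x).1.integral_prod_right
  exact IntegrableOn.congr_fun this (fun t ht => (h.rpow_smul_gaussRiesz_eq hN j x ht).symm)
    measurableSet_Ioi

theorem setIntegral_norm_rpow_smul_gaussRiesz_le (hN : 1 ≤ N) (h : LipCompact u) (j : Fin N)
    (x : RN N) : ∫ t in Set.Ioi (0 : ℝ), ‖t ^ (((N : ℝ) + 1) / 2 - 1) • gaussRiesz j u t x‖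
      ≤ Real.Gamma (((N : ℝ) + 1) / 2) * rieszMajorant u x := by
  obtain ⟨hi, hn⟩ := h.integrable_rpow_mul_gaussMoment_smul_bumpDiff hN j x
  calc _ = ∫ t in Set.Ioi (0 : ℝ),
        ‖∫ z, (t ^ (((N : ℝ) + 1) / 2 - 1) * gaussMoment j t z) • bumpDiff u x z‖ :=
        setIntegral_congr_fun measurableSet_Ioi fun t ht => by
          simp only [h.rpow_smul_gaussRiesz_eq hN j x ht]
    _ ≤ ∫ t in Set.Ioi (0 : ℝ),
        ∫ z, ‖(t ^ (((N : ℝ) + 1) / 2 - 1) * gaussMoment j t z) • bumpDiff u x z‖ :=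
        integral_mono hi.integral_prod_right.norm hi.norm.integral_prod_right
          fun t => norm_integral_le_integral_norm _
    _ = ∫ z, ∫ t in Set.Ioi (0 : ℝ),
        ‖(t ^ (((N : ℝ) + 1) / 2 - 1) * gaussMoment j t z) • bumpDiff u x z‖ :=
        (integral_integral_swap hi.norm).symm
    _ ≤ ∫ z, Real.Gamma (((N : ℝ) + 1) / 2) * (‖z‖ ^ (-(N : ℝ)) * ‖bumpDiff u x z‖) :=
        integral_mono hi.norm.integral_prod_left ((h.integrable_majorant hN x).const_mul _) hn
    _ = _ := by rw [integral_const_mul, rieszMajorant]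

theorem setIntegral_rpow_smul_gaussRiesz (hN : 1 ≤ N) (h : LipCompact u) (j : Fin N)
    (x : RN N) : ∫ t in Set.Ioi (0 : ℝ), t ^ (((N : ℝ) + 1) / 2 - 1) • gaussRiesz j u t x
      = Real.Gamma (((N : ℝ) + 1) / 2) • ∫ z, (z j * ‖z‖ ^ (-((N : ℝ) + 1))) • bumpDiff u x z := by
  obtain ⟨hi, hn⟩ := h.integrable_rpow_mul_gaussMoment_smul_bumpDiff hN j x
  calc _ = ∫ t in Set.Ioi (0 : ℝ),
        ∫ z, (t ^ (((N : ℝ) + 1) / 2 - 1) * gaussMoment j t z) • bumpDiff u x z :=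
        setIntegral_congr_fun measurableSet_Ioi fun t ht => by
          simp only [h.rpow_smul_gaussRiesz_eq hN j x ht]
    _ = ∫ z, ∫ t in Set.Ioi (0 : ℝ),
        (t ^ (((N : ℝ) + 1) / 2 - 1) * gaussMoment j t z) • bumpDiff u x z :=
        (integral_integral_swap hi).symm
    _ = _ := by
      rw [← integral_smul]
      congr 1 with z
      rw [integral_smul_const, setIntegral_rpow_mul_gaussMoment j (by positivity), smul_smul,
        show 2 * (((N : ℝ) + 1) / 2) = N + 1 by ring]

/-- The truncated region is symmetric under z ↦ -z, so oddness again removes the subtracted term. -/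
theorem rieszTruncated_eq (h : LipCompact u) (j : Fin N) (x : RN N) {ε : ℝ}
    (hε : 0 < ε) : rieszTruncated j u x ε = rieszConst N • ∫ z, {z : RN N | ε < ‖z‖}.indicator
      (fun z => (z j * ‖z‖ ^ (-((N : ℝ) + 1))) • bumpDiff u x z) z := by
  have hS : MeasurableSet {z : RN N | ε < ‖z‖} :=
    (isOpen_lt (by fun_prop) (by fun_prop)).measurableSet
  have hS' : MeasurableSet {y : RN N | ε < ‖x - y‖} :=
    (isOpen_lt (by fun_prop) (by fun_prop)).measurableSet
  rw [rieszTruncated, ← integral_indicator hS']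
  congr 1
  rw [← integral_sub_left_eq_self _ volume x]
  have hk : ∀ z : RN N, z j * ‖z‖ ^ (-((N : ℝ) + 1)) = z j / ‖z‖ ^ (N + 1) := fun z => by
    rw [Real.rpow_neg (norm_nonneg z), div_eq_mul_inv]; norm_cast
  have hk' := hk
  simp only [neg_add_rev] at hk'
  have hkb : ∀ z ∈ {z : RN N | ε < ‖z‖}, |z j * ‖z‖ ^ (-((N : ℝ) + 1))| ≤ ε ^ (-(N : ℝ)) := by
    intro z hz
    rw [abs_mul, abs_of_nonneg (Real.rpow_nonneg (norm_nonneg z) _)]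
    refine (?_ : _ ≤ ‖z‖ ^ (-(N : ℝ))).trans
      (Real.rpow_le_rpow_of_nonpos hε (le_of_lt hz) (by simp))
    have := abs_coord_mul_rpow_le j z
    rwa [show 2 * (((N : ℝ) + 1) / 2) = N + 1 by ring] at this
  have hkm : Measurable fun z : RN N => z j * ‖z‖ ^ (-((N : ℝ) + 1)) := by fun_prop
  have i1 : Integrable ({z : RN N | ε < ‖z‖}.indicator
      (fun z => (z j * ‖z‖ ^ (-((N : ℝ) + 1))) • u (x - z))) := by
    refine ((h.integrable.comp_sub_left x).norm.const_mul (ε ^ (-(N : ℝ)))).mono'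
      ((hkm.smul (h.continuous.measurable.comp (by fun_prop))).indicator hS).aestronglyMeasurable
      (ae_of_all _ fun z => ?_)
    by_cases hz : z ∈ {z : RN N | ε < ‖z‖}
    · rw [Set.indicator_of_mem hz, norm_smul]
      gcongr; exact hkb z hz
    · rw [Set.indicator_of_notMem hz, norm_zero]; positivity
  have hBm : Measurable ((Metric.ball (0 : RN N) 1).indicator (fun _ => u x)) :=
    measurable_const.indicator measurableSet_ball
  have i2 : Integrable ({z : RN N | ε < ‖z‖}.indicator (fun z =>
      (z j * ‖z‖ ^ (-((N : ℝ) + 1))) • (Metric.ball (0 : RN N) 1).indicator (fun _ => u x) z)) := by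
    have i3 : Integrable ((Metric.ball (0 : RN N) 1).indicator (fun _ => ‖u x‖)) :=
      (integrable_indicator_iff measurableSet_ball).2
        (integrableOn_const measure_ball_lt_top.ne)
    refine (i3.const_mul (ε ^ (-(N : ℝ)))).mono' ((hkm.smul hBm).indicator hS).aestronglyMeasurable
      (ae_of_all _ fun z => ?_)
    by_cases hz : z ∈ {z : RN N | ε < ‖z‖}
    · rw [Set.indicator_of_mem hz, norm_smul, norm_indicator_eq_indicator_norm]
      gcongr
      · exact Set.indicator_nonneg (fun _ _ => norm_nonneg _) _
      · exact hkb z hz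
    · rw [Set.indicator_of_notMem hz, norm_zero]
      exact mul_nonneg (by positivity) (Set.indicator_nonneg (fun _ _ => norm_nonneg _) _)
  have i0 : ∫ z, {z : RN N | ε < ‖z‖}.indicator (fun z =>
      (z j * ‖z‖ ^ (-((N : ℝ) + 1))) • (Metric.ball (0 : RN N) 1).indicator (fun _ => u x) z) z
      = 0 := by
    refine integral_eq_zero_of_neg fun z => ?_
    simp [Set.indicator]
    split_ifs <;> simp
  rw [← sub_zero (∫ z, _), ← i0, ← integral_sub ?_ i2]
  · congr 1 with z
    by_cases hz : ε < ‖z‖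
    · simp [hz, bumpDiff, smul_sub, hk']
    · simp [hz]
  · refine i1.congr (ae_of_all _ fun z => ?_)
    by_cases hz : ε < ‖z‖
    · simp [hz, hk']
    · simp [hz]

/-- Dominated convergence with the integrand of `rieszMajorant`. This existence of the principal
value gives the `limUnder` in the definition its meaning. -/
theorem tendsto_rieszTruncated (hN : 1 ≤ N) (h : LipCompact u) (j : Fin N) (x : RN N) :
    Tendsto (rieszTruncated j u x) (𝓝[>] 0)
      (𝓝 (rieszConst N • ∫ z, (z j * ‖z‖ ^ (-((N : ℝ) + 1))) • bumpDiff u x z)) := by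
  have hm : Measurable fun z : RN N => (z j * ‖z‖ ^ (-((N : ℝ) + 1))) • bumpDiff u x z :=
    Measurable.smul (by fun_prop) (h.measurable_bumpDiff_right x)
  have hlim : Tendsto (fun ε : ℝ => rieszConst N • ∫ z, {z : RN N | ε < ‖z‖}.indicator
      (fun z => (z j * ‖z‖ ^ (-((N : ℝ) + 1))) • bumpDiff u x z) z) (𝓝[>] 0)
      (𝓝 (rieszConst N • ∫ z, (z j * ‖z‖ ^ (-((N : ℝ) + 1))) • bumpDiff u x z)) := by
    refine Tendsto.const_smul ?_ _
    refine tendsto_integral_filter_of_dominated_convergence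
      (fun z => ‖z‖ ^ (-(N : ℝ)) * ‖bumpDiff u x z‖) ?_ ?_ (h.integrable_majorant hN x) ?_
    · exact Eventually.of_forall fun ε => (hm.indicator
        (isOpen_lt (by fun_prop) (by fun_prop)).measurableSet).aestronglyMeasurable
    · refine Eventually.of_forall fun ε => ae_of_all _ fun z => ?_
      refine (norm_indicator_le_norm_self _ z).trans ?_
      rw [norm_smul, norm_mul, Real.norm_eq_abs,
        Real.norm_of_nonneg (Real.rpow_nonneg (norm_nonneg z) _)]
      gcongr
      have := abs_coord_mul_rpow_le j z
      rwa [show 2 * (((N : ℝ) + 1) / 2) = N + 1 by ring] at this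
    · refine ae_of_all _ fun z => ?_
      rcases eq_or_ne z 0 with rfl | hz
      · have : ∀ ε : ℝ, {z : RN N | ε < ‖z‖}.indicator
          (fun z => (z j * ‖z‖ ^ (-((N : ℝ) + 1))) • bumpDiff u x z) 0 = 0 := fun ε => by
          simp [Set.indicator]
        simp only [this]; simp
      · refine tendsto_const_nhds.congr' ?_
        have : ∀ᶠ ε in 𝓝[>] (0 : ℝ), ε < ‖z‖ :=
          nhdsWithin_le_nhds (Iio_mem_nhds (norm_pos_iff.2 hz))
        filter_upwards [this] with ε hε
        rw [Set.indicator_of_mem (show z ∈ {z : RN N | ε < ‖z‖} from hε)]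
  refine hlim.congr' ?_
  filter_upwards [self_mem_nhdsWithin] with ε hε
  exact (h.rieszTruncated_eq j x hε).symm

/-- Gaussian subordination of the Riesz transform. -/
theorem rieszTransform_eq (hN : 1 ≤ N) (h : LipCompact u) (j : Fin N) (x : RN N) :
    rieszTransform j u x = (Real.pi ^ (((N : ℝ) + 1) / 2))⁻¹ •
      ∫ t in Set.Ioi (0 : ℝ), t ^ (((N : ℝ) + 1) / 2 - 1) • gaussRiesz j u t x := by
  rw [rieszTransform, (h.tendsto_rieszTruncated hN j x).limUnder_eq,
    h.setIntegral_rpow_smul_gaussRiesz hN, smul_smul, rieszConst, div_eq_mul_inv, mul_comm]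

end LipCompact

end RieszTransform

/-! ### The quadrant integral that produces |z|^{-m} -/

section Subordination

/-- Change of variables `t = s k` in an integral over the quadrant. -/
theorem integrable_and_integral_quadrant_scale {f : ℝ × ℝ → ℝ} (hf : Measurable f)
    (hg : Integrable (fun p : ℝ × ℝ => p.1 * f (p.1, p.1 * p.2))
      ((volume.restrict (Set.Ioi 0)).prod (volume.restrict (Set.Ioi 0)))) :
    Integrable f ((volume.restrict (Set.Ioi 0)).prod (volume.restrict (Set.Ioi 0))) ∧
    ∫ p, f p ∂((volume.restrict (Set.Ioi 0)).prod (volume.restrict (Set.Ioi 0)))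
      = ∫ p : ℝ × ℝ, p.1 * f (p.1, p.1 * p.2)
        ∂((volume.restrict (Set.Ioi 0)).prod (volume.restrict (Set.Ioi 0))) := by
  have hs : ∀ᵐ s ∂(volume.restrict (Set.Ioi (0 : ℝ))), 0 < s :=
    ae_restrict_mem measurableSet_Ioi
  have hscale : ∀ {s : ℝ}, 0 < s → ∀ φ : ℝ → ℝ,
      ∫ k in Set.Ioi (0 : ℝ), s * φ (s * k) = ∫ t in Set.Ioi (0 : ℝ), φ t := fun {s} hs φ => by
    rw [integral_const_mul, integral_comp_mul_left_Ioi φ 0 hs, mul_zero, smul_eq_mul,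
      mul_inv_cancel_left₀ hs.ne']
  obtain ⟨h1, h2⟩ := (integrable_prod_iff hg.aestronglyMeasurable).1 hg
  have hfi : Integrable f ((volume.restrict (Set.Ioi 0)).prod (volume.restrict (Set.Ioi 0))) := by
    refine (integrable_prod_iff hf.aestronglyMeasurable).2 ⟨?_, ?_⟩
    · filter_upwards [h1, hs] with s h1s hs
      have : IntegrableOn (fun k => f (s, s * k)) (Set.Ioi 0) := by
        refine IntegrableOn.congr_fun (Integrable.const_mul h1s s⁻¹) (fun k _ => ?_)
          measurableSet_Ioi
        simp only [inv_mul_cancel_left₀ hs.ne']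
      simpa [IntegrableOn] using
        (integrableOn_Ioi_comp_mul_left_iff (fun t => f (s, t)) 0 hs).1 this
    · refine h2.congr ?_
      filter_upwards [hs] with s hs
      refine Eq.trans ?_ (hscale hs fun t => ‖f (s, t)‖)
      simp [abs_of_pos hs]
  refine ⟨hfi, ?_⟩
  rw [integral_prod _ hfi, integral_prod _ hg]
  refine integral_congr_ae ?_
  filter_upwards [hs] with s hs
  exact (hscale hs fun t => f (s, t)).symm

/-- Two Gamma integrals combined by Γ(m + 1) = m Γ(m). It is applied with m/2 and N/2, where the
factor m - n is nonzero because m < N. -/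
theorem gamma_moment_difference {m n r : ℝ} (hm : 0 < m) (hn : 0 ≤ n) (hr : 0 < r) :
    IntegrableOn (fun s : ℝ => s ^ (m - 1) * (Real.exp (-(r * s)) * (r * s - n))) (Set.Ioi 0) ∧
    ∫ s in Set.Ioi (0 : ℝ), s ^ (m - 1) * (Real.exp (-(r * s)) * (r * s - n))
      = (m - n) * Real.Gamma m * r ^ (-m) ∧
    ∫ s in Set.Ioi (0 : ℝ), ‖s ^ (m - 1) * (Real.exp (-(r * s)) * (r * s - n))‖
      ≤ (m + n) * Real.Gamma m * r ^ (-m) := by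
  have i1 := (integrableOn_rpow_mul_exp_neg_mul (p := m + 1) (by linarith) hr).const_mul r
  have i0 := (integrableOn_rpow_mul_exp_neg_mul hm hr).const_mul n
  have e1 := Real.integral_rpow_mul_exp_neg_mul_Ioi (a := m + 1) (by linarith) hr
  have e0 := Real.integral_rpow_mul_exp_neg_mul_Ioi hm hr
  have hr1 : r * (1 / r) ^ (m + 1) = r ^ (-m) := by
    rw [one_div, Real.inv_rpow hr.le, ← Real.rpow_neg hr.le, neg_add, Real.rpow_add hr,
      Real.rpow_neg_one]
    field_simp
  have hr0 : (1 / r) ^ m = r ^ (-m) := by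
    rw [one_div, Real.inv_rpow hr.le, ← Real.rpow_neg hr.le]
  have hpt : ∀ s ∈ Set.Ioi (0 : ℝ), s ^ (m - 1) * (Real.exp (-(r * s)) * (r * s - n))
      = r * (s ^ (m + 1 - 1) * Real.exp (-(r * s))) - n * (s ^ (m - 1) * Real.exp (-(r * s))) := by
    intro s hs
    have : s ^ (m + 1 - 1) = s ^ (m - 1) * s := by
      rw [← Real.rpow_add_one (ne_of_gt hs)]; congr 1; ring
    rw [this]; ring
  refine ⟨?_, ?_, ?_⟩
  · exact IntegrableOn.congr_fun (i1.sub i0) (fun s hs => (hpt s hs).symm) measurableSet_Ioi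
  · rw [setIntegral_congr_fun measurableSet_Ioi hpt, integral_sub i1 i0, integral_const_mul,
      integral_const_mul, e1, e0, ← mul_assoc, hr1, hr0, Real.Gamma_add_one hm.ne']
    ring
  · calc _ ≤ ∫ s in Set.Ioi (0 : ℝ), (r * (s ^ (m + 1 - 1) * Real.exp (-(r * s)))
          + n * (s ^ (m - 1) * Real.exp (-(r * s)))) := by
          refine setIntegral_mono_on ?_ (i1.add i0) measurableSet_Ioi fun s hs => ?_
          · exact (IntegrableOn.congr_fun (i1.sub i0) (fun s hs => (hpt s hs).symm)
              measurableSet_Ioi).norm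
          · rw [hpt s hs]
            have hs' : (0 : ℝ) ≤ s := le_of_lt hs
            refine (norm_sub_le _ _).trans_eq ?_
            rw [Real.norm_of_nonneg (by positivity), Real.norm_of_nonneg (by positivity)]
      _ = _ := by
          rw [integral_add i1 i0, integral_const_mul,
            integral_const_mul, e1, e0, ← mul_assoc, hr1, hr0, Real.Gamma_add_one hm.ne']
          ring

theorem integrableOn_rpow_mul_one_add_rpow {a b : ℝ} (ha : -1 < a) (hab : a + b < -1) (hb : b ≤ 0) :
    IntegrableOn (fun k : ℝ => k ^ a * (1 + k) ^ b) (Set.Ioi 0) := by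
  have hm : Measurable fun k : ℝ => k ^ a * (1 + k) ^ b := by fun_prop
  rw [← Set.Ioc_union_Ioi_eq_Ioi zero_le_one]
  refine IntegrableOn.union ?_ ?_
  · have h := (intervalIntegral.intervalIntegrable_rpow' (a := 0) (b := 1) ha)
    rw [intervalIntegrable_iff_integrableOn_Ioc_of_le zero_le_one] at h
    refine Integrable.mono' h hm.aestronglyMeasurable ?_
    filter_upwards [ae_restrict_mem measurableSet_Ioc] with k hk
    have hk0 : 0 < k := hk.1
    rw [Real.norm_of_nonneg (by positivity)]
    exact mul_le_of_le_one_right (by positivity)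
      (Real.rpow_le_one_of_one_le_of_nonpos (by linarith) hb)
  · refine Integrable.mono' (integrableOn_Ioi_rpow_of_lt hab one_pos) hm.aestronglyMeasurable ?_
    filter_upwards [ae_restrict_mem measurableSet_Ioi] with k hk
    have hk0 : (0 : ℝ) < k := lt_trans one_pos hk
    rw [Real.norm_of_nonneg (by positivity), Real.rpow_add hk0]
    gcongr ?_ * ?_
    exact Real.rpow_le_rpow_of_nonpos hk0 (by linarith) hb

/-- The subordinated kernel of `∑_j K_j * R_j` in the Gaussian parameters `(s, t)`. -/
noncomputable def quadrantKernel (N : ℕ) (m : ℝ) (ρ : ℝ) (p : ℝ × ℝ) : ℝ :=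
  p.1 ^ ((m + 1) / 2 - 1) * p.2 ^ (((N : ℝ) + 1) / 2 - 1) *
    (Real.pi ^ ((N : ℝ) / 2) * (p.1 + p.2) ^ (-((N : ℝ) / 2) - 1)
        * (Real.exp (-(p.1 * p.2 / (p.1 + p.2) * ρ ^ 2))
          * (p.1 * p.2 / (p.1 + p.2) * ρ ^ 2 - N / 2)))

theorem measurable_quadrantKernel (N : ℕ) (m : ℝ) :
    Measurable fun p : ℝ × (ℝ × ℝ) => quadrantKernel N m p.1 p.2 := by
  unfold quadrantKernel; fun_prop

/-- Under t = s k the Gaussian rate is linear in s, and the powers of s, with the Jacobian included,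
collapse to s^{m/2-1}. For fixed k what remains is a Gamma integral. -/
theorem quadrantKernel_scale {N : ℕ} {m ρ s k : ℝ} (hs : 0 < s) (hk : 0 < k) :
    s * quadrantKernel N m ρ (s, s * k)
      = Real.pi ^ ((N : ℝ) / 2) * (k ^ (((N : ℝ) + 1) / 2 - 1) * (1 + k) ^ (-((N : ℝ) / 2) - 1)) *
        (s ^ (m / 2 - 1) * (Real.exp (-(k / (1 + k) * ρ ^ 2 * s)) *
          (k / (1 + k) * ρ ^ 2 * s - N / 2))) := by
  have e : s * (s * k) / (s + s * k) * ρ ^ 2 = k / (1 + k) * ρ ^ 2 * s := by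
    field_simp
  simp only [quadrantKernel, e]
  rw [show s + s * k = s * (1 + k) by ring, Real.mul_rpow hs.le hk.le,
    Real.mul_rpow hs.le (by positivity)]
  have : s ^ (m / 2 - 1) = s * (s ^ ((m + 1) / 2 - 1) * s ^ (((N : ℝ) + 1) / 2 - 1) *
      s ^ (-((N : ℝ) / 2) - 1)) := by
    nth_rewrite 2 [← Real.rpow_one s]
    rw [← Real.rpow_add hs, ← Real.rpow_add hs, ← Real.rpow_add hs]; congr 1; ring
  rw [this]; ring

/-- After t = s k, integrating in s first leaves ρ^{-m} D(k) times a constant. The limit constant c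
is nonzero since D has positive integral and m ≠ N; the norm bound serves the later use of Fubini in
z. -/
theorem quadrantKernel_integral {N : ℕ} {m : ℝ} (hm : 0 < m) (hmN : m < N) :
    ∃ C c : ℝ, 0 ≤ C ∧ c ≠ 0 ∧ ∀ ρ : ℝ, 0 < ρ →
      Integrable (quadrantKernel N m ρ)
        ((volume.restrict (Set.Ioi 0)).prod (volume.restrict (Set.Ioi 0))) ∧
      ∫ p, ‖quadrantKernel N m ρ p‖ ∂((volume.restrict (Set.Ioi 0)).prod
        (volume.restrict (Set.Ioi 0))) ≤ C * ρ ^ (-m) ∧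
      ∫ p, quadrantKernel N m ρ p ∂((volume.restrict (Set.Ioi 0)).prod
        (volume.restrict (Set.Ioi 0))) = c * ρ ^ (-m) := by
  have hN0 : (0 : ℝ) < N := hm.trans hmN
  set D : ℝ → ℝ := fun k => k ^ (((N : ℝ) - 1 - m) / 2) * (1 + k) ^ ((m - N) / 2 - 1) with hD
  -- At 0 the exponent exceeds -1 because m < N + 1; at infinity the two exponents add up to -3/2,
  -- whatever m is.
  have hDi : IntegrableOn D (Set.Ioi 0) :=
    integrableOn_rpow_mul_one_add_rpow (by linarith) (by linarith) (by linarith)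
  have hDpos : 0 < ∫ k in Set.Ioi (0 : ℝ), D k := by
    refine (setIntegral_pos_iff_support_of_nonneg_ae ?_ hDi).2 ?_
    · filter_upwards [ae_restrict_mem measurableSet_Ioi] with k hk
      have : (0 : ℝ) < k := hk
      simp only [hD, Pi.zero_apply]; positivity
    · have : Set.Ioi (0 : ℝ) ⊆ Function.support D ∩ Set.Ioi 0 := fun k hk => by
        have hk' : (0 : ℝ) < k := hk
        exact ⟨by simp only [hD, Function.mem_support]; positivity, hk⟩
      exact lt_of_lt_of_le (by simp) (measure_mono this)
  have hΓ : 0 < Real.Gamma (m / 2) := Real.Gamma_pos_of_pos (by linarith)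
  have hs : ∀ᵐ s ∂(volume.restrict (Set.Ioi (0 : ℝ))), 0 < s := ae_restrict_mem measurableSet_Ioi
  have hDk : ∀ {ρ k : ℝ}, 0 < ρ → 0 < k →
      k ^ (((N : ℝ) + 1) / 2 - 1) * (1 + k) ^ (-((N : ℝ) / 2) - 1) *
        (k / (1 + k) * ρ ^ 2) ^ (-(m / 2)) = D k * ρ ^ (-m) := by
    intro ρ k hρ hk
    have h1 : 0 < 1 + k := by linarith
    rw [Real.mul_rpow (by positivity) (by positivity), Real.div_rpow hk.le h1.le,
      ← Real.rpow_two, ← Real.rpow_mul hρ.le, div_eq_mul_inv (k ^ (-(m / 2))),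
      ← Real.rpow_neg h1.le, hD]
    simp only
    rw [show ((N : ℝ) - 1 - m) / 2 = (((N : ℝ) + 1) / 2 - 1) + -(m / 2) by ring,
      show (m - N) / 2 - 1 = (-((N : ℝ) / 2) - 1) + - -(m / 2) by ring,
      Real.rpow_add hk, Real.rpow_add h1, show (2 : ℝ) * -(m / 2) = -m by ring]
    ring
  refine ⟨Real.pi ^ ((N : ℝ) / 2) * ((m / 2 + N / 2) * Real.Gamma (m / 2)) *
      ∫ k in Set.Ioi (0 : ℝ), D k,
    Real.pi ^ ((N : ℝ) / 2) * ((m / 2 - N / 2) * Real.Gamma (m / 2)) *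
      ∫ k in Set.Ioi (0 : ℝ), D k, by positivity, ?_, fun ρ hρ => ?_⟩
  · have : m / 2 - N / 2 ≠ 0 := by intro h; linarith
    have := Real.pi_pos
    positivity
  set P : Measure (ℝ × ℝ) := (volume.restrict (Set.Ioi 0)).prod (volume.restrict (Set.Ioi 0))
    with hP
  have hqm : Measurable (quadrantKernel N m ρ) :=
    (measurable_quadrantKernel N m).comp measurable_prodMk_left
  let g : ℝ × ℝ → ℝ := fun p => p.1 * quadrantKernel N m ρ (p.1, p.1 * p.2)
  have hgm : Measurable g := measurable_fst.mul (hqm.comp (by fun_prop))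
  have hin : ∀ {k : ℝ}, 0 < k → IntegrableOn (fun s => g (s, k)) (Set.Ioi 0) ∧
      ∫ s in Set.Ioi (0 : ℝ), g (s, k) =
        Real.pi ^ ((N : ℝ) / 2) * ((m / 2 - N / 2) * Real.Gamma (m / 2)) * (D k * ρ ^ (-m)) ∧
      ∫ s in Set.Ioi (0 : ℝ), ‖g (s, k)‖ ≤
        Real.pi ^ ((N : ℝ) / 2) * ((m / 2 + N / 2) * Real.Gamma (m / 2)) * (D k * ρ ^ (-m)) := by
    intro k hk
    obtain ⟨a1, a2, a3⟩ := gamma_moment_difference (m := m / 2) (n := N / 2)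
      (r := k / (1 + k) * ρ ^ 2) (by linarith) (by linarith) (by positivity)
    have hg : ∀ s ∈ Set.Ioi (0 : ℝ), g (s, k) = Real.pi ^ ((N : ℝ) / 2) *
        (k ^ (((N : ℝ) + 1) / 2 - 1) * (1 + k) ^ (-((N : ℝ) / 2) - 1)) *
        (s ^ (m / 2 - 1) * (Real.exp (-(k / (1 + k) * ρ ^ 2 * s)) *
          (k / (1 + k) * ρ ^ 2 * s - N / 2))) := fun s hs => quadrantKernel_scale hs hk
    refine ⟨IntegrableOn.congr_fun (Integrable.const_mul a1 _) (fun s hs => (hg s hs).symm)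
      measurableSet_Ioi, ?_, ?_⟩
    · rw [setIntegral_congr_fun measurableSet_Ioi hg, integral_const_mul, a2, ← hDk hρ hk]
      ring
    · rw [setIntegral_congr_fun measurableSet_Ioi (fun s hs => congrArg norm (hg s hs))]
      simp_rw [norm_mul (_ * (_ * _))]
      rw [integral_const_mul, Real.norm_of_nonneg (by positivity), ← hDk hρ hk]
      refine (mul_le_mul_of_nonneg_left a3 (by positivity)).trans_eq ?_
      ring
  have hgi : Integrable g P := by
    refine (integrable_prod_iff' hgm.aestronglyMeasurable).2 ⟨?_, ?_⟩
    · filter_upwards [hs] with k hk using (hin hk).1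
    · refine Integrable.mono' ((hDi.mul_const (ρ ^ (-m))).const_mul
        (Real.pi ^ ((N : ℝ) / 2) * ((m / 2 + N / 2) * Real.Gamma (m / 2))))
        hgm.aestronglyMeasurable.norm.prod_swap.integral_prod_right' ?_
      filter_upwards [hs] with k hk
      rw [Real.norm_of_nonneg (integral_nonneg fun _ => norm_nonneg _)]
      exact (hin hk).2.2
  obtain ⟨b1, b2⟩ := integrable_and_integral_quadrant_scale hqm hgi
  refine ⟨b1, ?_, ?_⟩
  · have hgn : (fun p => ‖g p‖) =ᵐ[P] fun p => p.1 * ‖quadrantKernel N m ρ (p.1, p.1 * p.2)‖ := by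
      have : ∀ᵐ p ∂P, 0 < p.1 := Measure.quasiMeasurePreserving_fst.ae hs
      filter_upwards [this] with p hp
      simp [g, abs_of_pos hp]
    have := (integrable_and_integral_quadrant_scale hqm.norm (hgi.norm.congr hgn)).2
    rw [this, ← integral_congr_ae hgn, integral_prod_symm _ hgi.norm, mul_assoc,
      ← integral_mul_const, ← integral_const_mul]
    refine integral_mono_ae hgi.norm.integral_prod_right
      ((hDi.mul_const (ρ ^ (-m))).const_mul _) ?_
    filter_upwards [hs] with k hk using (hin hk).2.2
  · rw [b2, integral_prod_symm _ hgi, mul_assoc, ← integral_mul_const, ← integral_const_mul]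
    refine integral_congr_ae ?_
    filter_upwards [hs] with k hk using (hin hk).2.1

end Subordination

/-! ### Recovering |·|^{-m} * u from the Riesz transforms -/

section Composition

variable {N : ℕ} {𝕜 : Type*} [RCLike 𝕜]

theorem exists_bound_gaussMoment (j : Fin N) {t : ℝ} (ht : 0 < t) :
    ∃ B : ℝ, ∀ z : RN N, ‖gaussMoment j t z‖ ≤ B := by
  refine ⟨1 + 1 / t, fun z => (norm_gaussMoment_le j t z).trans ?_⟩
  have h1 : Real.exp (-(t * ‖z‖ ^ 2)) ≤ (1 + t * ‖z‖ ^ 2)⁻¹ := by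
    rw [Real.exp_neg]
    gcongr
    linarith [Real.add_one_le_exp (t * ‖z‖ ^ 2)]
  refine (mul_le_mul_of_nonneg_left h1 (norm_nonneg z)).trans ?_
  rw [← div_eq_mul_inv, div_le_iff₀ (by positivity)]
  have : (1 + 1 / t) * (1 + t * ‖z‖ ^ 2) = 1 + 1 / t + t * ‖z‖ ^ 2 + ‖z‖ ^ 2 := by
    field_simp; ring
  rw [this]
  have h2 : 0 ≤ 1 / t := by positivity
  have h3 : 0 ≤ t * ‖z‖ ^ 2 := by positivity
  nlinarith [sq_nonneg (‖z‖ - 1)]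

theorem sum_gaussMoment_mul (s t : ℝ) (y z : RN N) :
    ∑ j, gaussMoment j s y * gaussMoment j t z
      = inner ℝ y z * (Real.exp (-(s * ‖y‖ ^ 2)) * Real.exp (-(t * ‖z‖ ^ 2))) := by
  simp only [gaussMoment, PiLp.inner_apply, Finset.sum_mul]
  refine Finset.sum_congr rfl fun j _ => ?_
  simp; ring

theorem integrable_gaussMoment_mul_gaussMoment (hN : 1 ≤ N) (j : Fin N) {s t : ℝ} (hs : 0 < s)
    (ht : 0 < t) (z : RN N) :
    Integrable fun y : RN N => gaussMoment j s y * gaussMoment j t (z - y) := by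
  obtain ⟨B, hB⟩ := exists_bound_gaussMoment j ht
  exact (integrable_gaussMoment hN j hs).mul_bdd (c := B)
    (((continuous_gaussMoment j).comp (by fun_prop :
      Continuous fun y : RN N => (t, z - y))).aestronglyMeasurable) (ae_of_all _ fun y => hB _)

namespace LipCompact

variable {u : RN N → 𝕜}

theorem stronglyMeasurable_gaussRiesz (h : LipCompact u) (j : Fin N) :
    StronglyMeasurable fun p : ℝ × RN N => gaussRiesz j u p.1 p.2 := by
  have hc : Continuous fun q : (ℝ × RN N) × RN N => gaussMoment j q.1.1 q.2 • u (q.1.2 - q.2) :=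
    ((continuous_gaussMoment j).comp (by fun_prop :
      Continuous fun q : (ℝ × RN N) × RN N => (q.1.1, q.2))).smul (h.continuous.comp (by fun_prop))
  exact hc.stronglyMeasurable.integral_prod_right

theorem stronglyMeasurable_rieszTransform (hN : 1 ≤ N) (h : LipCompact u) (j : Fin N) :
    StronglyMeasurable (rieszTransform j u) := by
  have hF : StronglyMeasurable fun q : RN N × ℝ =>
      q.2 ^ (((N : ℝ) + 1) / 2 - 1) • gaussRiesz j u q.2 q.1 :=
    (by fun_prop : Measurable fun q : RN N × ℝ => q.2 ^ (((N : ℝ) + 1) / 2 - 1))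
      |>.stronglyMeasurable.smul
      ((h.stronglyMeasurable_gaussRiesz j).comp_measurable measurable_swap)
  rw [show rieszTransform j u = _ from funext (h.rieszTransform_eq hN j)]
  exact (hF.integral_prod_right' (ν := volume.restrict (Set.Ioi 0))).const_smul
    ((Real.pi ^ (((N : ℝ) + 1) / 2))⁻¹)

/-- The decay `|R_j u(x)| ≤ C (1 + |x|)^{-N}`. -/
theorem exists_rieszTransform_le (hN : 1 ≤ N) (h : LipCompact u) :
    ∃ C : ℝ, 0 ≤ C ∧ ∀ j x, ‖rieszTransform j u x‖ ≤ C * (1 + ‖x‖) ^ (-(N : ℝ)) := by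
  obtain ⟨C, hC0, hC⟩ := h.exists_rieszMajorant_le hN
  have hΓ := Real.Gamma_pos_of_pos (show 0 < ((N : ℝ) + 1) / 2 by positivity)
  refine ⟨(Real.pi ^ (((N : ℝ) + 1) / 2))⁻¹ * (Real.Gamma (((N : ℝ) + 1) / 2) * C),
    by positivity, fun j x => ?_⟩
  rw [h.rieszTransform_eq hN j x, norm_smul, Real.norm_of_nonneg (by positivity), mul_assoc,
    mul_assoc]
  gcongr ?_ * ?_
  refine (norm_integral_le_integral_norm _).trans
    ((h.setIntegral_norm_rpow_smul_gaussRiesz_le hN j x).trans ?_)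
  gcongr; exact hC x

theorem exists_decay (h : LipCompact u) :
    ∃ C : ℝ, 0 ≤ C ∧ ∀ x, ‖u x‖ ≤ C * (1 + ‖x‖) ^ (-(N : ℝ)) := by
  obtain ⟨B, hB⟩ := h.exists_bound
  obtain ⟨R, hR1, hR⟩ := h.exists_radius
  have hB0 : 0 ≤ B := (norm_nonneg _).trans (hB 0)
  refine ⟨B * (1 + R) ^ (N : ℝ), by positivity, fun x => ?_⟩
  by_cases hx : R < ‖x‖
  · rw [hR x hx, norm_zero]; positivity
  · rw [mul_assoc, Real.rpow_neg (by positivity), ← div_eq_mul_inv]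
    refine (hB x).trans (le_mul_of_one_le_right hB0 ?_)
    rw [one_le_div (by positivity)]
    gcongr; exact not_lt.1 hx

theorem integrable_norm_rpow_mul_norm (hN : 1 ≤ N) (h : LipCompact u) {m : ℝ} (hm : 0 < m)
    (hmN : m < N) (x : RN N) : Integrable fun z : RN N => ‖z‖ ^ (-m) * ‖u (x - z)‖ := by
  obtain ⟨C, hC0, hC⟩ := h.exists_decay
  have hu := h.continuous.measurable
  refine ((integrable_norm_rpow_mul_decay hN hm hmN x).const_mul C).mono'
    (Measurable.aestronglyMeasurable (by fun_prop)) (ae_of_all _ fun z => ?_)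
  rw [Real.norm_of_nonneg (by positivity)]
  calc _ ≤ ‖z‖ ^ (-m) * (C * (1 + ‖x - z‖) ^ (-(N : ℝ))) := by gcongr; exact hC _
    _ = _ := by ring

theorem integrable_kernel_smul_rieszTransform (hN : 1 ≤ N) (h : LipCompact u) {m : ℝ} (hm : 0 < m)
    (hmN : m < N) (j : Fin N) (x : RN N) :
    Integrable fun y : RN N => (y j * ‖y‖ ^ (-(m + 1))) • rieszTransform j u (x - y) := by
  obtain ⟨C, hC0, hC⟩ := h.exists_rieszTransform_le hN
  refine ((integrable_norm_rpow_mul_decay hN hm hmN x).const_mul C).mono'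
    ((Measurable.aestronglyMeasurable (by fun_prop)).smul
      ((h.stronglyMeasurable_rieszTransform hN j).comp_measurable
        (by fun_prop)).aestronglyMeasurable) (ae_of_all _ fun z => ?_)
  rw [norm_smul, norm_mul, Real.norm_eq_abs, Real.norm_of_nonneg (by positivity)]
  calc _ ≤ ‖z‖ ^ (-m) * (C * (1 + ‖x - z‖) ^ (-(N : ℝ))) := by
        gcongr
        · exact abs_coord_mul_rpow_neg_add_one_le j z m
        · exact hC _ _
    _ = _ := by ring

/-- The integrand of the subordinated composition. -/
noncomputable def composedIntegrand (u : RN N → 𝕜) (m : ℝ) (j : Fin N) (x y : RN N) (p : ℝ × ℝ) :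
    𝕜 :=
  (p.1 ^ ((m + 1) / 2 - 1) * gaussMoment j p.1 y) •
    (p.2 ^ (((N : ℝ) + 1) / 2 - 1) • gaussRiesz j u p.2 (x - y))

/-- For fixed y the norm is a product of a function of s and a function of t, whose integrals are at
most multiples of |y|^{-m} and of (1 + |x - y|)^{-N}. -/
theorem integrable_composedIntegrand (hN : 1 ≤ N) (h : LipCompact u) {m : ℝ} (hm : 0 < m)
    (hmN : m < N) (j : Fin N) (x : RN N) :
    Integrable (fun q : RN N × (ℝ × ℝ) => composedIntegrand u m j x q.1 q.2)
      (volume.prod ((volume.restrict (Set.Ioi 0)).prod (volume.restrict (Set.Ioi 0)))) := by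
  obtain ⟨C, hC0, hC⟩ := h.exists_rieszMajorant_le hN
  have hΓ := Real.Gamma_pos_of_pos (show 0 < ((N : ℝ) + 1) / 2 by positivity)
  have hΓm := Real.Gamma_pos_of_pos (show 0 < (m + 1) / 2 by positivity)
  have hmeas : AEStronglyMeasurable
      (fun q : RN N × (ℝ × ℝ) => composedIntegrand u m j x q.1 q.2)
      (volume.prod ((volume.restrict (Set.Ioi 0)).prod (volume.restrict (Set.Ioi 0)))) := by
    refine StronglyMeasurable.aestronglyMeasurable ?_
    refine StronglyMeasurable.smul ?_ (StronglyMeasurable.smul ?_ ?_)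
    · have h1 : Measurable fun q : RN N × (ℝ × ℝ) => q.2.1 ^ ((m + 1) / 2 - 1) := by fun_prop
      have h2 : Measurable fun q : RN N × (ℝ × ℝ) => gaussMoment j q.2.1 q.1 :=
        (continuous_gaussMoment j).measurable.comp
          (by fun_prop : Measurable fun q : RN N × (ℝ × ℝ) => (q.2.1, q.1))
      exact (h1.mul h2).stronglyMeasurable
    · have h1 : Measurable fun q : RN N × (ℝ × ℝ) => q.2.2 ^ (((N : ℝ) + 1) / 2 - 1) := by fun_prop
      exact h1.stronglyMeasurable
    · exact (h.stronglyMeasurable_gaussRiesz j).comp_measurable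
          (by fun_prop : Measurable fun q : RN N × (ℝ × ℝ) => (q.2.2, x - q.1))
  refine (integrable_prod_iff hmeas).2 ⟨ae_of_all _ fun y => ?_, ?_⟩
  · exact Integrable.smul_prod (integrableOn_rpow_mul_gaussMoment j (by positivity) y)
      (h.integrableOn_rpow_smul_gaussRiesz hN j (x - y))
  · refine ((integrable_norm_rpow_mul_decay hN hm hmN x).const_mul
      (Real.Gamma ((m + 1) / 2) * (Real.Gamma (((N : ℝ) + 1) / 2) * C))).mono'
      hmeas.norm.integral_prod_right' (ae_of_all _ fun y => ?_)
    rw [Real.norm_of_nonneg (integral_nonneg fun _ => norm_nonneg _)]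
    simp only [composedIntegrand, norm_smul (_ * _)]
    rw [integral_prod_mul (fun s : ℝ => ‖s ^ ((m + 1) / 2 - 1) * gaussMoment j s y‖)
      (fun t : ℝ => ‖t ^ (((N : ℝ) + 1) / 2 - 1) • gaussRiesz j u t (x - y)‖),
      setIntegral_norm_rpow_mul_gaussMoment j (by positivity),
      show 2 * ((m + 1) / 2) = m + 1 by ring]
    calc _ ≤ (Real.Gamma ((m + 1) / 2) * ‖y‖ ^ (-m)) *
          (Real.Gamma (((N : ℝ) + 1) / 2) * (C * (1 + ‖x - y‖) ^ (-(N : ℝ)))) := by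
          gcongr
          · exact abs_coord_mul_rpow_neg_add_one_le j y m
          · exact (h.setIntegral_norm_rpow_smul_gaussRiesz_le hN j (x - y)).trans
              (by gcongr; exact hC _)
      _ = _ := by ring

theorem integral_kernel_smul_rieszTransform (hN : 1 ≤ N) (h : LipCompact u) {m : ℝ} (hm : 0 < m)
    (hmN : m < N) (j : Fin N) (x : RN N) :
    ∫ y : RN N, (y j * ‖y‖ ^ (-(m + 1))) • rieszTransform j u (x - y)
      = ((Real.Gamma ((m + 1) / 2))⁻¹ * (Real.pi ^ (((N : ℝ) + 1) / 2))⁻¹) •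
        ∫ p : ℝ × ℝ, (∫ y : RN N, composedIntegrand u m j x y p)
          ∂((volume.restrict (Set.Ioi 0)).prod (volume.restrict (Set.Ioi 0))) := by
  have hΓm := Real.Gamma_pos_of_pos (show 0 < (m + 1) / 2 by positivity)
  rw [← integral_integral_swap (h.integrable_composedIntegrand hN hm hmN j x), ← integral_smul]
  congr 1 with y
  simp only [composedIntegrand]
  rw [integral_prod_smul (fun s : ℝ => s ^ ((m + 1) / 2 - 1) * gaussMoment j s y)
    (fun t : ℝ => t ^ (((N : ℝ) + 1) / 2 - 1) • gaussRiesz j u t (x - y)),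
    setIntegral_rpow_mul_gaussMoment j (by positivity), h.rieszTransform_eq hN, smul_smul,
    smul_smul, show 2 * ((m + 1) / 2) = m + 1 by ring]
  congr 1
  field_simp

/-- Associativity of convolution reduces the claim to convolving two Gaussian moments. Only after
summing over j does the product become y · (z - y), whose Gaussian integral is radial in z. -/
theorem sum_integral_gaussMoment_smul_gaussRiesz (hN : 1 ≤ N) (h : LipCompact u) {s t : ℝ}
    (hs : 0 < s) (ht : 0 < t) (x : RN N) :
    ∑ j, ∫ y : RN N, gaussMoment j s y • gaussRiesz j u t (x - y)
      = ∫ z : RN N, (Real.pi ^ ((N : ℝ) / 2) * (s + t) ^ (-((N : ℝ) / 2) - 1)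
        * (Real.exp (-(s * t / (s + t) * ‖z‖ ^ 2)) * (s * t / (s + t) * ‖z‖ ^ 2 - N / 2)))
          • u (x - z) := by
  have hi : ∀ j : Fin N, Integrable (fun q : RN N × RN N =>
      (gaussMoment j s q.1 * gaussMoment j t (q.2 - q.1)) • u (x - q.2)) (volume.prod volume) := by
    intro j
    obtain ⟨B, hB⟩ := exists_bound_gaussMoment j ht
    have h1 := ((integrable_gaussMoment hN j hs).norm.mul_prod
      (h.integrable.comp_sub_left x).norm).const_mul B
    refine h1.mono' (Continuous.aestronglyMeasurable ?_) (ae_of_all _ fun q => ?_)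
    · have hu := h.continuous
      unfold gaussMoment
      fun_prop
    · rw [norm_smul, norm_mul]
      calc _ ≤ ‖gaussMoment j s q.1‖ * B * ‖u (x - q.2)‖ := by gcongr; exact hB _
        _ = _ := by ring
  have h1 : ∀ j : Fin N, ∫ y : RN N, gaussMoment j s y • gaussRiesz j u t (x - y)
      = ∫ z : RN N, ∫ y : RN N, (gaussMoment j s y * gaussMoment j t (z - y)) • u (x - z) := by
    intro j
    rw [← integral_integral_swap (hi j)]
    congr 1 with y
    rw [gaussRiesz, ← integral_smul,
      ← integral_sub_right_eq_self
        (fun z => gaussMoment j s y • gaussMoment j t z • u (x - y - z)) y]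
    congr 1 with z
    rw [smul_smul, sub_sub, add_sub_cancel]
  simp_rw [h1]
  rw [← integral_finsetSum _ fun j _ => (hi j).integral_prod_right]
  congr 1 with z
  simp_rw [integral_smul_const]
  rw [← Finset.sum_smul, ← integral_finsetSum _ fun j _ =>
    integrable_gaussMoment_mul_gaussMoment hN j hs ht z]
  simp_rw [sum_gaussMoment_mul]
  rw [integral_inner_mul_exp_mul_exp hN hs ht]

theorem integrable_quadrantKernel_smul (hN : 1 ≤ N) (h : LipCompact u) {m : ℝ} (hm : 0 < m)
    (hmN : m < N) (x : RN N) :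
    Integrable (fun q : RN N × (ℝ × ℝ) => quadrantKernel N m ‖q.1‖ q.2 • u (x - q.1))
      (volume.prod ((volume.restrict (Set.Ioi 0)).prod (volume.restrict (Set.Ioi 0)))) := by
  have : Nonempty (Fin N) := ⟨⟨0, hN⟩⟩
  obtain ⟨C, c, hC0, hc, hk⟩ := quadrantKernel_integral hm hmN
  have hz : ∀ᵐ z : RN N, z ≠ 0 := Measure.ae_ne volume 0
  have hmeas : AEStronglyMeasurable
      (fun q : RN N × (ℝ × ℝ) => quadrantKernel N m ‖q.1‖ q.2 • u (x - q.1))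
      (volume.prod ((volume.restrict (Set.Ioi 0)).prod (volume.restrict (Set.Ioi 0)))) := by
    have hu := h.continuous.measurable
    exact (((measurable_quadrantKernel N m).comp (by fun_prop : Measurable fun q : RN N × (ℝ × ℝ) =>
      (‖q.1‖, q.2))).smul (by fun_prop : Measurable fun q : RN N × (ℝ × ℝ) =>
        u (x - q.1))).aestronglyMeasurable
  refine (integrable_prod_iff hmeas).2 ⟨?_, ?_⟩
  · filter_upwards [hz] with z hz
    exact (hk ‖z‖ (norm_pos_iff.2 hz)).1.smul_const (u (x - z))
  · refine ((h.integrable_norm_rpow_mul_norm hN hm hmN x).const_mul C).mono'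
      hmeas.norm.integral_prod_right' ?_
    filter_upwards [hz] with z hz
    rw [Real.norm_of_nonneg (integral_nonneg fun _ => norm_nonneg _)]
    simp only [norm_smul]
    rw [integral_mul_const, ← mul_assoc]
    gcongr
    exact (hk ‖z‖ (norm_pos_iff.2 hz)).2.1

end LipCompact

/-- The identity `∑_j K_j * R_j u = c |·|^{-m} * u`, where `K_j(y) = y_j |y|^{-m-1}`. -/
theorem exists_sum_kernel_rieszTransform_eq (hN : 1 ≤ N) {m : ℝ} (hm : 0 < m) (hmN : m < N) :
    ∃ c : ℝ, c ≠ 0 ∧ ∀ {u : RN N → 𝕜}, LipCompact u → ∀ x : RN N,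
      ∑ j, ∫ y : RN N, (y j * ‖y‖ ^ (-(m + 1))) • rieszTransform j u (x - y)
        = c • ∫ z : RN N, ‖z‖ ^ (-m) • u (x - z) := by
  have : Nonempty (Fin N) := ⟨⟨0, hN⟩⟩
  have hΓm := Real.Gamma_pos_of_pos (show 0 < (m + 1) / 2 by positivity)
  obtain ⟨C, c, hC0, hc, hk⟩ := quadrantKernel_integral hm hmN
  have hπ := Real.pi_pos
  -- The normalizations of the two subordinations, times the constant of the quadrant integral.
  refine ⟨((Real.Gamma ((m + 1) / 2))⁻¹ * (Real.pi ^ (((N : ℝ) + 1) / 2))⁻¹) * c, by positivity,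
    fun {u} h x => ?_⟩
  simp_rw [h.integral_kernel_smul_rieszTransform hN hm hmN]
  rw [← Finset.smul_sum, mul_smul _ c]
  congr 1
  rw [← integral_finsetSum (f := fun j p => ∫ y, LipCompact.composedIntegrand u m j x y p)
    Finset.univ fun j _ => (h.integrable_composedIntegrand hN hm hmN j x).integral_prod_right]
  have hpos : ∀ᵐ p ∂((volume.restrict (Set.Ioi (0 : ℝ))).prod (volume.restrict (Set.Ioi (0 : ℝ)))),
      0 < p.1 ∧ 0 < p.2 :=
    (Measure.quasiMeasurePreserving_fst.ae (ae_restrict_mem measurableSet_Ioi)).and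
      (Measure.quasiMeasurePreserving_snd.ae (ae_restrict_mem measurableSet_Ioi))
  have h1 : (fun p => ∑ j, ∫ y, LipCompact.composedIntegrand u m j x y p)
      =ᵐ[(volume.restrict (Set.Ioi (0 : ℝ))).prod (volume.restrict (Set.Ioi (0 : ℝ)))]
      fun p => ∫ z : RN N, quadrantKernel N m ‖z‖ p • u (x - z) := by
    filter_upwards [hpos] with p hp
    have : ∀ (j : Fin N) (y : RN N), LipCompact.composedIntegrand u m j x y p
        = (p.1 ^ ((m + 1) / 2 - 1) * p.2 ^ (((N : ℝ) + 1) / 2 - 1)) •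
          (gaussMoment j p.1 y • gaussRiesz j u p.2 (x - y)) := fun j y => by
      simp only [LipCompact.composedIntegrand, smul_smul]; congr 1; ring
    simp_rw [this, integral_smul]
    rw [← Finset.smul_sum, h.sum_integral_gaussMoment_smul_gaussRiesz hN hp.1 hp.2,
      ← integral_smul]
    simp only [smul_smul, quadrantKernel]
  rw [integral_congr_ae h1, ← integral_integral_swap (h.integrable_quadrantKernel_smul hN hm hmN x),
    ← integral_smul]
  refine integral_congr_ae ?_
  filter_upwards [Measure.ae_ne volume (0 : RN N)] with z hz
  rw [integral_smul_const, (hk ‖z‖ (norm_pos_iff.2 hz)).2.2, smul_smul]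

end Composition

/-! ### Curl freeness and the resulting cancellation -/

section CurlFree

variable {N : ℕ} {𝕜 : Type*} [RCLike 𝕜]

/-- For j ≠ k the factor z_j is constant along e_k, so only the exponential is differentiated. The
result is symmetric in j and k, which is the source of curl freeness. -/
theorem hasLineDerivAt_gaussMoment {j k : Fin N} (hjk : j ≠ k) (t : ℝ) (z y : RN N) :
    HasLineDerivAt ℝ (fun y => gaussMoment j t (y - z))
      (-(2 * t) * ((y - z) j * (y - z) k) * Real.exp (-(t * ‖y - z‖ ^ 2))) y
      (EuclideanSpace.single k (1 : ℝ)) := by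
  unfold HasLineDerivAt
  have h1 : HasDerivAt (fun s : ℝ => y + s • EuclideanSpace.single k (1 : ℝ) - z)
      (EuclideanSpace.single k (1 : ℝ)) 0 := by
    simpa using (((hasDerivAt_id (0 : ℝ)).smul_const
      (EuclideanSpace.single k (1 : ℝ) : RN N)).const_add y).sub_const z
  have h2 := ((h1.norm_sq.const_mul t).neg).exp.const_mul ((y - z) j)
  have e : (fun s : ℝ => gaussMoment j t (y + s • EuclideanSpace.single k (1 : ℝ) - z)) = fun s =>
      (y - z) j * Real.exp (-(t * ‖y + s • EuclideanSpace.single k (1 : ℝ) - z‖ ^ 2)) := by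
    ext s
    simp [gaussMoment, hjk]
  rw [e]
  refine h2.congr_deriv ?_
  simp [EuclideanSpace.inner_single_right]
  ring

namespace LipCompact

variable {u : RN N → 𝕜}

/-- Reduces weak identities for R_j u to identities for a single Gaussian parameter t. -/
theorem integral_smul_rieszTransform (hN : 1 ≤ N) (h : LipCompact u) (j : Fin N) {ψ : RN N → ℝ}
    (hψ : Continuous ψ) (hψc : HasCompactSupport ψ) :
    ∫ y, ψ y • rieszTransform j u y = (Real.pi ^ (((N : ℝ) + 1) / 2))⁻¹ •
      ∫ t in Set.Ioi (0 : ℝ), t ^ (((N : ℝ) + 1) / 2 - 1) • ∫ y, ψ y • gaussRiesz j u t y := by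
  obtain ⟨C, hC0, hC⟩ := h.exists_rieszMajorant_le hN
  have hΓ := Real.Gamma_pos_of_pos (show 0 < ((N : ℝ) + 1) / 2 by positivity)
  have hmeas : AEStronglyMeasurable (fun q : RN N × ℝ =>
      ψ q.1 • (q.2 ^ (((N : ℝ) + 1) / 2 - 1) • gaussRiesz j u q.2 q.1))
      (volume.prod (volume.restrict (Set.Ioi 0))) := by
    have h1 : Measurable fun q : RN N × ℝ => q.2 ^ (((N : ℝ) + 1) / 2 - 1) := by fun_prop
    exact ((hψ.stronglyMeasurable.comp_measurable measurable_fst).smul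
      (h1.stronglyMeasurable.smul ((h.stronglyMeasurable_gaussRiesz j).comp_measurable
        measurable_swap))).aestronglyMeasurable
  have hi : Integrable (fun q : RN N × ℝ =>
      ψ q.1 • (q.2 ^ (((N : ℝ) + 1) / 2 - 1) • gaussRiesz j u q.2 q.1))
      (volume.prod (volume.restrict (Set.Ioi 0))) := by
    refine (integrable_prod_iff hmeas).2 ⟨ae_of_all _ fun y => ?_, ?_⟩
    · exact Integrable.smul (ψ y) (h.integrableOn_rpow_smul_gaussRiesz hN j y)
    · refine ((hψ.integrable_of_hasCompactSupport hψc).norm.const_mul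
        (Real.Gamma (((N : ℝ) + 1) / 2) * C)).mono'
        hmeas.norm.integral_prod_right' (ae_of_all _ fun y => ?_)
      rw [Real.norm_of_nonneg (integral_nonneg fun _ => norm_nonneg _)]
      simp only [norm_smul (ψ y)]
      rw [integral_const_mul, mul_comm]
      gcongr
      refine (h.setIntegral_norm_rpow_smul_gaussRiesz_le hN j y).trans ?_
      gcongr
      refine (hC y).trans (mul_le_of_le_one_right hC0 ?_)
      exact Real.rpow_le_one_of_one_le_of_nonpos (by linarith [norm_nonneg y]) (by simp)
  calc _ = (Real.pi ^ (((N : ℝ) + 1) / 2))⁻¹ • ∫ y, ∫ t in Set.Ioi (0 : ℝ),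
        ψ y • (t ^ (((N : ℝ) + 1) / 2 - 1) • gaussRiesz j u t y) := by
        rw [← integral_smul]
        congr 1 with y
        rw [h.rieszTransform_eq hN, integral_smul, smul_comm]
    _ = _ := by
        rw [integral_integral_swap hi]
        congr 2 with t
        rw [← integral_smul]
        congr 1 with y
        rw [smul_comm]

/-- Pairing the test function with the Gaussian moment first lets derivatives fall on the Gaussian,
so u is never differentiated. -/
theorem integral_smul_gaussRiesz (h : LipCompact u) (j : Fin N) {t : ℝ} (ht : 0 < t)
    {ψ : RN N → ℝ} (hψ : Continuous ψ) (hψc : HasCompactSupport ψ) :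
    ∫ y, ψ y • gaussRiesz j u t y = ∫ z, (∫ y, gaussMoment j t (y - z) * ψ y) • u z := by
  obtain ⟨B, hB⟩ := exists_bound_gaussMoment j ht
  have hi : Integrable (fun q : RN N × RN N => (gaussMoment j t (q.1 - q.2) * ψ q.1) • u q.2)
      (volume.prod volume) := by
    have h1 := ((hψ.integrable_of_hasCompactSupport (μ := volume) hψc).norm.mul_prod
      h.integrable.norm).const_mul B
    refine h1.mono' (Continuous.aestronglyMeasurable ?_) (ae_of_all _ fun q => ?_)
    · have hu := h.continuous
      unfold gaussMoment
      fun_prop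
    · rw [norm_smul, norm_mul]
      calc _ ≤ B * ‖ψ q.1‖ * ‖u q.2‖ := by gcongr; exact hB _
        _ = _ := by ring
  simp_rw [← integral_smul_const]
  rw [← integral_integral_swap hi]
  congr 1 with y
  rw [gaussRiesz, ← integral_smul,
    ← integral_sub_left_eq_self (fun z => (gaussMoment j t (y - z) * ψ y) • u z) volume y]
  congr 1 with z
  rw [sub_sub_cancel, smul_smul, mul_comm]

/-- The Riesz transform is weakly curl free. -/
theorem integral_lineDeriv_smul_rieszTransform_comm (hN : 1 ≤ N) (h : LipCompact u) {j k : Fin N}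
    (hjk : j ≠ k) {θ θj θk : RN N → ℝ} (hθ : Continuous θ) (hθc : HasCompactSupport θ)
    (hj : Continuous θj) (hjc : HasCompactSupport θj)
    (hk : Continuous θk) (hkc : HasCompactSupport θk)
    (hθj : ∀ y, HasLineDerivAt ℝ θ (θj y) y (EuclideanSpace.single j 1))
    (hθk : ∀ y, HasLineDerivAt ℝ θ (θk y) y (EuclideanSpace.single k 1)) :
    ∫ y, θk y • rieszTransform j u y = ∫ y, θj y • rieszTransform k u y := by
  rw [h.integral_smul_rieszTransform hN j hk hkc, h.integral_smul_rieszTransform hN k hj hjc]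
  congr 1
  refine setIntegral_congr_fun measurableSet_Ioi fun t ht => ?_
  rw [h.integral_smul_gaussRiesz j ht hk hkc, h.integral_smul_gaussRiesz k ht hj hjc]
  congr 2 with z
  congr 1
  -- After integration by parts the right-hand side is symmetric in a and b, so the two pairings
  -- agree.
  have ibp : ∀ {a b : Fin N} {θb : RN N → ℝ}, a ≠ b → Continuous θb → HasCompactSupport θb →
      (∀ y, HasLineDerivAt ℝ θ (θb y) y (EuclideanSpace.single b 1)) →
      ∫ y, gaussMoment a t (y - z) * θb y =
        -∫ y, -(2 * t) * ((y - z) a * (y - z) b) * Real.exp (-(t * ‖y - z‖ ^ 2)) * θ y := by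
    intro a b θb hab hb hbc hθb
    refine integral_bilinear_hasLineDerivAt_right_eq_neg_left_of_integrable
      (B := ContinuousLinearMap.mul ℝ ℝ) ?_ ?_ ?_
      (fun y _ => hasLineDerivAt_gaussMoment hab t z y) (fun y _ => hθb y)
    · refine Continuous.integrable_of_hasCompactSupport ?_ ?_
      · simp only [ContinuousLinearMap.mul_apply']; fun_prop
      · exact hθc.mul_left
    · refine Continuous.integrable_of_hasCompactSupport ?_ ?_
      · simp only [ContinuousLinearMap.mul_apply', gaussMoment]; fun_prop
      · exact hbc.mul_left
    · refine Continuous.integrable_of_hasCompactSupport ?_ ?_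
      · simp only [ContinuousLinearMap.mul_apply', gaussMoment]; fun_prop
      · exact hθc.mul_left
  rw [ibp hjk hk hkc hθk, ibp hjk.symm hj hjc hθj]
  congr 2 with y
  ring

end LipCompact

/-- A radial cutoff: `1` for `|y|² ≤ ρ²/2` and `0` for `|y| ≥ ρ`. -/
noncomputable def radialCutoff (ρ : ℝ) (y : RN N) : ℝ :=
  Real.smoothTransition (2 - 2 / ρ ^ 2 * ‖y‖ ^ 2)

theorem continuous_radialCutoff (ρ : ℝ) : Continuous (radialCutoff ρ : RN N → ℝ) := by
  unfold radialCutoff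
  exact Real.smoothTransition.continuous.comp (by fun_prop)

theorem radialCutoff_eq_zero {ρ : ℝ} (hρ : 0 < ρ) {y : RN N} (hy : ρ ≤ ‖y‖) :
    radialCutoff ρ y = 0 := by
  refine Real.smoothTransition.zero_of_nonpos ?_
  have : ρ ^ 2 ≤ ‖y‖ ^ 2 := by gcongr
  rw [sub_nonpos, div_mul_eq_mul_div, le_div_iff₀ (by positivity)]
  linarith

theorem hasCompactSupport_radialCutoff {ρ : ℝ} (hρ : 0 < ρ) :
    HasCompactSupport (radialCutoff ρ : RN N → ℝ) := by
  refine HasCompactSupport.intro (isCompact_closedBall 0 ρ) fun y hy => radialCutoff_eq_zero hρ ?_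
  have : ρ < ‖y‖ := by simpa using hy
  exact this.le

/-- The cutoff equals 1 where 2|y| ≤ ρ, and elsewhere the right-hand side is at least 1. -/
theorem abs_one_sub_radialCutoff_le {ρ : ℝ} (hρ : 0 < ρ) {y : RN N} (hy : ‖y‖ ≤ ρ) :
    |1 - radialCutoff ρ y| ≤ 2 * (‖y‖ / ρ) := by
  by_cases h : 2 * ‖y‖ ≤ ρ
  · have : radialCutoff ρ y = 1 := by
      refine Real.smoothTransition.one_of_one_le ?_
      have : 2 / ρ ^ 2 * ‖y‖ ^ 2 ≤ 1 := by
        rw [div_mul_eq_mul_div, div_le_one (by positivity)]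
        nlinarith [norm_nonneg y]
      linarith
    rw [this, sub_self, abs_zero]; positivity
  · have h0 := Real.smoothTransition.nonneg (2 - 2 / ρ ^ 2 * ‖y‖ ^ 2)
    have h1 := Real.smoothTransition.le_one (2 - 2 / ρ ^ 2 * ‖y‖ ^ 2)
    rw [radialCutoff, abs_of_nonneg (by linarith), ← mul_div_assoc]
    have : 1 ≤ 2 * ‖y‖ / ρ := by
      rw [one_le_div hρ]; linarith
    linarith

theorem continuous_deriv_smoothTransition : Continuous (deriv Real.smoothTransition) :=
  (Real.smoothTransition.contDiff (n := 1)).continuous_deriv le_rfl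

theorem deriv_smoothTransition_eq_zero {s : ℝ} (hs : s < 0) :
    deriv Real.smoothTransition s = 0 := by
  have : Real.smoothTransition =ᶠ[𝓝 s] fun _ => 0 := by
    filter_upwards [Iio_mem_nhds hs] with r hr
    exact Real.smoothTransition.zero_of_nonpos (le_of_lt hr)
  rw [this.deriv_eq, deriv_const]

theorem exists_bound_deriv_smoothTransition :
    ∃ M : ℝ, 0 ≤ M ∧ ∀ s ≤ 2, |deriv Real.smoothTransition s| ≤ M := by
  obtain ⟨M, hM⟩ := (isCompact_Icc (a := (0 : ℝ)) (b := 2)).exists_bound_of_continuousOn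
    continuous_deriv_smoothTransition.continuousOn
  refine ⟨M, (norm_nonneg _).trans (hM 0 (by simp)), fun s hs => ?_⟩
  by_cases h : s < 0
  · rw [deriv_smoothTransition_eq_zero h, abs_zero]
    exact (norm_nonneg _).trans (hM 0 (by simp))
  · exact hM s ⟨not_lt.1 h, hs⟩

/-- The radial factor of the derivative of `radialCutoff`. -/
noncomputable def radialCutoffDeriv (ρ : ℝ) (y : RN N) : ℝ :=
  -(4 / ρ ^ 2) * deriv Real.smoothTransition (2 - 2 / ρ ^ 2 * ‖y‖ ^ 2)

theorem continuous_radialCutoffDeriv (ρ : ℝ) : Continuous (radialCutoffDeriv ρ : RN N → ℝ) := by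
  unfold radialCutoffDeriv
  exact continuous_const.mul (continuous_deriv_smoothTransition.comp (by fun_prop))

theorem radialCutoffDeriv_eq_zero {ρ : ℝ} (hρ : 0 < ρ) {y : RN N} (hy : ρ < ‖y‖) :
    radialCutoffDeriv ρ y = 0 := by
  rw [radialCutoffDeriv, deriv_smoothTransition_eq_zero, mul_zero]
  have : ρ ^ 2 < ‖y‖ ^ 2 := by gcongr
  rw [sub_neg, div_mul_eq_mul_div, lt_div_iff₀ (by positivity)]
  linarith

theorem hasCompactSupport_radialCutoffDeriv {ρ : ℝ} (hρ : 0 < ρ) :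
    HasCompactSupport (radialCutoffDeriv ρ : RN N → ℝ) :=
  HasCompactSupport.intro (isCompact_closedBall 0 ρ) fun y hy =>
    radialCutoffDeriv_eq_zero hρ (by simpa using hy)

theorem hasLineDerivAt_coord_mul_radialCutoff (ρ : ℝ) (k i : Fin N) (y : RN N) :
    HasLineDerivAt ℝ (fun y => y k * radialCutoff ρ y)
      ((if k = i then 1 else 0) * radialCutoff ρ y + y k * (y i * radialCutoffDeriv ρ y)) y
      (EuclideanSpace.single i (1 : ℝ)) := by
  unfold HasLineDerivAt
  have h1 : HasDerivAt (fun s : ℝ => y + s • EuclideanSpace.single i (1 : ℝ))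
      (EuclideanSpace.single i (1 : ℝ)) 0 := by
    simpa using ((hasDerivAt_id (0 : ℝ)).smul_const
      (EuclideanSpace.single i (1 : ℝ) : RN N)).const_add y
  have h2 := (h1.norm_sq.const_mul (2 / ρ ^ 2)).const_sub 2
  have h3 : HasDerivAt Real.smoothTransition (deriv Real.smoothTransition
      (2 - 2 / ρ ^ 2 * ‖y + (0 : ℝ) • EuclideanSpace.single i (1 : ℝ)‖ ^ 2)) _ :=
    ((Real.smoothTransition.contDiff (n := 1)).differentiable (by simp) _).hasDerivAt
  have h4 := h3.comp (0 : ℝ) h2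
  have h5 : HasDerivAt (fun s : ℝ => (y + s • EuclideanSpace.single i (1 : ℝ) : RN N) k)
      (if k = i then 1 else 0) 0 := by
    have := ((hasDerivAt_id (0 : ℝ)).mul_const
      ((EuclideanSpace.single i (1 : ℝ) : RN N) k)).const_add (y k)
    simpa using this
  refine (h5.mul h4).congr_deriv ?_
  simp [EuclideanSpace.inner_single_right, radialCutoff, radialCutoffDeriv]
  left
  ring

theorem norm_rieszTransform_le (u : RN N → 𝕜) (j : Fin N) (x : RN N) :
    ‖rieszTransform j u x‖ ≤ ‖rieszVector u x‖ := by
  simpa [rieszVector] using PiLp.norm_apply_le (rieszVector u x) j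

/-- Cancellation: the mean of `R_j u` against a radial cutoff gains a factor `|y| / ρ`. -/
theorem exists_enorm_integral_radialCutoff_le (hN : 2 ≤ N) : ∃ C : ℝ≥0, ∀ {u : RN N → 𝕜},
    LipCompact u → ∀ (j : Fin N) {ρ : ℝ}, 0 < ρ →
      ‖∫ y, radialCutoff ρ y • rieszTransform j u y‖ₑ
        ≤ C * ∫⁻ y in {y : RN N | ‖y‖ ≤ ρ}, ENNReal.ofReal (‖y‖ / ρ) * ‖rieszVector u y‖ₑ := by
  obtain ⟨M, hM0, hM⟩ := exists_bound_deriv_smoothTransition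
  -- Two error terms, each with weight at most 4M |y|/ρ.
  refine ⟨Real.toNNReal (8 * M), fun {u} h j ρ hρ => ?_⟩
  have hN1 : 1 ≤ N := by omega
  -- The dimension hypothesis N ≥ 2 supplies the second direction.
  obtain ⟨k, hjk⟩ : ∃ k : Fin N, j ≠ k := by
    have : Nontrivial (Fin N) := Fin.nontrivial_iff_two_le.2 hN
    obtain ⟨k, hk⟩ := exists_ne j
    exact ⟨k, hk.symm⟩
  have hφ := continuous_radialCutoff (N := N) ρ
  have hφc := hasCompactSupport_radialCutoff (N := N) hρ
  have hd := continuous_radialCutoffDeriv (N := N) ρ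
  have hdc := hasCompactSupport_radialCutoffDeriv (N := N) hρ
  obtain ⟨C₀, hC₀, hR⟩ := h.exists_rieszTransform_le hN1
  have hRi : ∀ (i : Fin N) {ψ : RN N → ℝ}, Continuous ψ → HasCompactSupport ψ →
      Integrable fun y => ψ y • rieszTransform i u y := by
    intro i ψ hψ hψc
    refine (hψ.integrable_of_hasCompactSupport hψc).smul_bdd C₀
      (h.stronglyMeasurable_rieszTransform hN1 i).aestronglyMeasurable (ae_of_all _ fun y => ?_)
    refine (hR i y).trans (mul_le_of_le_one_right hC₀ ?_)
    exact Real.rpow_le_one_of_one_le_of_nonpos (by linarith [norm_nonneg y]) (by simp)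
  have c1 : ∀ i : Fin N, Continuous fun y : RN N => y k * (y i * radialCutoffDeriv ρ y) :=
    fun i => by fun_prop
  have s1 : ∀ i : Fin N, HasCompactSupport fun y : RN N => y k * (y i * radialCutoffDeriv ρ y) :=
    fun i => (hdc.mul_left (f := fun y : RN N => y i)).mul_left
  -- With θ = y_k φ, the derivative ∂_k θ contains φ itself; everything else carries y_k times a
  -- first derivative of φ, of size O(|y|²/ρ²) = O(|y|/ρ) on the support. Solving for ∫ φ R_j u
  -- gives the claim.
  have curl := h.integral_lineDeriv_smul_rieszTransform_comm hN1 hjk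
    (θ := fun y => y k * radialCutoff ρ y)
    (θj := fun y => y k * (y j * radialCutoffDeriv ρ y))
    (θk := fun y => radialCutoff ρ y + y k * (y k * radialCutoffDeriv ρ y))
    (by fun_prop) hφc.mul_left (c1 j) (s1 j) (hφ.add (c1 k)) (hφc.add (s1 k))
    (fun y => by simpa [hjk.symm] using hasLineDerivAt_coord_mul_radialCutoff ρ k j y)
    (fun y => by simpa using hasLineDerivAt_coord_mul_radialCutoff ρ k k y)
  simp only [add_smul] at curl
  rw [integral_add (hRi j hφ hφc) (hRi j (c1 k) (s1 k)), ← eq_sub_iff_add_eq,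
    ← integral_sub (hRi k (c1 j) (s1 j)) (hRi j (c1 k) (s1 k))] at curl
  rw [curl]
  have hS : MeasurableSet {y : RN N | ‖y‖ ≤ ρ} :=
    (isClosed_le (by fun_prop) (by fun_prop)).measurableSet
  refine (enorm_integral_le_lintegral_enorm _).trans ?_
  rw [← lintegral_indicator hS, ← lintegral_const_mul' _ _ ENNReal.coe_ne_top]
  refine lintegral_mono fun y => ?_
  by_cases hy : y ∈ {y : RN N | ‖y‖ ≤ ρ}
  · have hy' : ‖y‖ ≤ ρ := hy
    rw [Set.indicator_of_mem hy, ← ofReal_norm, ← ofReal_norm,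
      ENNReal.ofNNReal_toNNReal,
      ← ENNReal.ofReal_mul (by positivity), ← ENNReal.ofReal_mul (by positivity)]
    refine ENNReal.ofReal_le_ofReal ?_
    have hdb : |radialCutoffDeriv ρ y| ≤ 4 / ρ ^ 2 * M := by
      rw [radialCutoffDeriv, abs_mul, abs_neg, abs_of_nonneg (by positivity)]
      gcongr
      refine hM _ ?_
      have : 0 ≤ 2 / ρ ^ 2 * ‖y‖ ^ 2 := by positivity
      linarith
    have hb : ∀ i : Fin N, |y k * (y i * radialCutoffDeriv ρ y)| ≤ 4 * M * (‖y‖ / ρ) := by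
      intro i
      rw [abs_mul, abs_mul]
      calc _ ≤ ‖y‖ * (‖y‖ * (4 / ρ ^ 2 * M)) := by
            gcongr
            · exact abs_coord_le_norm y k
            · exact abs_coord_le_norm y i
        _ = 4 * M * (‖y‖ / ρ) * (‖y‖ / ρ) := by field_simp
        _ ≤ 4 * M * (‖y‖ / ρ) * 1 := by
            gcongr; exact (div_le_one hρ).2 hy'
        _ = _ := mul_one _
    refine (norm_sub_le _ _).trans ?_
    rw [norm_smul, norm_smul, Real.norm_eq_abs, Real.norm_eq_abs]
    calc _ ≤ 4 * M * (‖y‖ / ρ) * ‖rieszVector u y‖ + 4 * M * (‖y‖ / ρ) * ‖rieszVector u y‖ := by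
          gcongr
          · exact hb j
          · exact norm_rieszTransform_le u k y
          · exact hb k
          · exact norm_rieszTransform_le u j y
      _ = _ := by ring
  · have hy' : ρ < ‖y‖ := not_le.1 hy
    rw [radialCutoffDeriv_eq_zero hρ hy']
    simp

end CurlFree

/-! ### Pointwise bound of the potential by the two-region kernel -/

section Pointwise

variable {N : ℕ} {𝕜 : Type*} [RCLike 𝕜]

theorem abs_rpow_neg_sub_rpow_neg_le {p a b c : ℝ} (hp : 0 < p) (hc : 0 < c) (ha : c ≤ a)
    (hb : c ≤ b) : |a ^ (-p) - b ^ (-p)| ≤ p * c ^ (-(p + 1)) * |a - b| := by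
  have h := Convex.norm_image_sub_le_of_norm_hasDerivWithin_le (s := Set.Ici c)
    (f := fun t : ℝ => t ^ (-p)) (f' := fun t => -p * t ^ (-p - 1)) (C := p * c ^ (-(p + 1)))
    (x := b) (y := a) (fun t ht => ?_) (fun t ht => ?_) (convex_Ici c) hb ha
  · simpa using h
  · have ht0 : t ≠ 0 := (lt_of_lt_of_le hc ht).ne'
    exact (Real.hasDerivAt_rpow_const (Or.inl ht0)).hasDerivWithinAt
  · have ht0 : 0 < t := lt_of_lt_of_le hc ht
    rw [norm_mul, norm_neg, Real.norm_of_nonneg hp.le, Real.norm_of_nonneg (by positivity),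
      show -p - 1 = -(p + 1) by ring]
    gcongr ?_ * ?_
    exact Real.rpow_le_rpow_of_nonpos hc ht (by linarith)

/-- The kernel `z_j |z|^{-m-1}`. -/
noncomputable def oddKernel (m : ℝ) (j : Fin N) (z : RN N) : ℝ := z j * ‖z‖ ^ (-(m + 1))

/-- The kernel dominating the potential: `|y| |x|^{-m-1}` if `2|y| ≤ |x|`, else `|x-y|^{-m}`. -/
noncomputable def twoRegionKernel (m : ℝ) (x y : RN N) : ℝ≥0∞ :=
  if 2 * ‖y‖ ≤ ‖x‖ then ‖y‖ₑ * (1 / ‖x‖ₑ ^ (m + 1)) else 1 / ‖x - y‖ₑ ^ m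

theorem one_div_enorm_rpow {z : RN N} (hz : z ≠ 0) (p : ℝ) :
    1 / ‖z‖ₑ ^ p = ENNReal.ofReal (‖z‖ ^ (-p)) := by
  have hz' := norm_pos_iff.2 hz
  rw [← ofReal_norm, ENNReal.ofReal_rpow_of_pos hz', one_div,
    ← ENNReal.ofReal_inv_of_pos (by positivity), Real.rpow_neg (norm_nonneg z)]

theorem abs_oddKernel_le (m : ℝ) (j : Fin N) (z : RN N) : |oddKernel m j z| ≤ ‖z‖ ^ (-m) := by
  rw [oddKernel, abs_mul, abs_of_nonneg (Real.rpow_nonneg (norm_nonneg z) _)]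
  exact abs_coord_mul_rpow_neg_add_one_le j z m

theorem enorm_oddKernel_le (m : ℝ) (j : Fin N) (z : RN N) :
    ‖oddKernel m j z‖ₑ ≤ 1 / ‖z‖ₑ ^ m := by
  rcases eq_or_ne z 0 with rfl | hz
  · simp [oddKernel]
  · rw [one_div_enorm_rpow hz, ← ofReal_norm]
    exact ENNReal.ofReal_le_ofReal (abs_oddKernel_le m j z)

theorem twoRegionKernel_of_le {m : ℝ} {x y : RN N} (hx : x ≠ 0) (hxy : 2 * ‖y‖ ≤ ‖x‖) :
    twoRegionKernel m x y = ENNReal.ofReal (‖y‖ * ‖x‖ ^ (-(m + 1))) := by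
  rw [twoRegionKernel, if_pos hxy, one_div_enorm_rpow hx, ← ofReal_norm,
    ← ENNReal.ofReal_mul (norm_nonneg y)]

/-- Both |x - y| and |x| are at least |x|/2, which gives the factor 2^{m+1}. The change of the
coordinate contributes 1 and the mean value bound for the power contributes 2(m + 1), whence 2m + 3.
-/
theorem abs_oddKernel_sub_sub_le {m : ℝ} (hm : 0 < m) (j : Fin N) {x y : RN N} (hx : x ≠ 0)
    (hxy : 2 * ‖y‖ ≤ ‖x‖) :
    |oddKernel m j (x - y) - oddKernel m j x|
      ≤ 2 ^ (m + 1) * (2 * m + 3) * (‖y‖ * ‖x‖ ^ (-(m + 1))) := by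
  have hx' := norm_pos_iff.2 hx
  set c := ‖x‖ / 2 with hc
  have hc0 : 0 < c := by positivity
  have h1 : c ≤ ‖x - y‖ := by
    have := norm_sub_norm_le x y
    rw [hc]; linarith
  have h2 : c ≤ ‖x‖ := by rw [hc]; linarith
  have h3 : |‖x - y‖ - ‖x‖| ≤ ‖y‖ := by
    have := abs_norm_sub_norm_le (x - y) x
    simpa using this
  have e : oddKernel m j (x - y) - oddKernel m j x = -(y j) * ‖x - y‖ ^ (-(m + 1)) +
      x j * (‖x - y‖ ^ (-(m + 1)) - ‖x‖ ^ (-(m + 1))) := by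
    simp only [oddKernel, PiLp.sub_apply]; ring
  have hcx : c ^ (-(m + 1)) = 2 ^ (m + 1) * ‖x‖ ^ (-(m + 1)) := by
    rw [hc, Real.div_rpow (norm_nonneg x) (by norm_num), Real.rpow_neg (by norm_num : (0 : ℝ) ≤ 2),
      div_inv_eq_mul, mul_comm]
  have hcc : ‖x‖ * c ^ (-(m + 1 + 1)) = 2 * c ^ (-(m + 1)) := by
    rw [show ‖x‖ = 2 * c by rw [hc]; ring, mul_assoc]
    congr 1
    nth_rewrite 1 [← Real.rpow_one c]
    rw [← Real.rpow_add hc0]; congr 1; ring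
  rw [e]
  calc _ ≤ |y j| * ‖x - y‖ ^ (-(m + 1)) +
        |x j| * |‖x - y‖ ^ (-(m + 1)) - ‖x‖ ^ (-(m + 1))| := by
        refine (abs_add_le _ _).trans_eq ?_
        rw [abs_mul, abs_mul, abs_neg, abs_of_nonneg (Real.rpow_nonneg (norm_nonneg (x - y)) _)]
    _ ≤ ‖y‖ * c ^ (-(m + 1)) + ‖x‖ * ((m + 1) * c ^ (-(m + 1 + 1)) * ‖y‖) := by
        have hp := Real.rpow_le_rpow_of_nonpos hc0 h1 (show -(m + 1) ≤ 0 by linarith)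
        refine add_le_add (mul_le_mul (abs_coord_le_norm y j) hp (by positivity) (by positivity))
          (mul_le_mul (abs_coord_le_norm x j) ?_ (abs_nonneg _) (by positivity))
        exact (abs_rpow_neg_sub_rpow_neg_le (by linarith) hc0 h1 h2).trans (by gcongr)
    _ = ‖y‖ * c ^ (-(m + 1)) + (m + 1) * (‖x‖ * c ^ (-(m + 1 + 1))) * ‖y‖ := by ring
    _ = _ := by rw [hcc, hcx]; ring

/-- Where 2|y| ≤ |x|, both K_j(x - y) - K_j(x) and (1 - φ(y)) K_j(x) are O(|y| |x|^{-m-1}). Where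
2|y| > |x|, the cutoff vanishes and the size bound on K_j is the second branch of the kernel. -/
theorem exists_enorm_oddKernel_sub_cutoff_le {m : ℝ} (hm : 0 < m) : ∃ A : ℝ≥0,
    ∀ (j : Fin N) (x y : RN N),
      ‖oddKernel m j (x - y) - radialCutoff (‖x‖ / 2) y * oddKernel m j x‖ₑ
        ≤ A * twoRegionKernel m x y := by
  -- The summand 4 comes from |1 - φ| ≤ 2|y|/(|x|/2).
  refine ⟨Real.toNNReal (2 ^ (m + 1) * (2 * m + 3) + 4), fun j x y => ?_⟩
  have hA1 : (1 : ℝ≥0∞) ≤ (Real.toNNReal (2 ^ (m + 1) * (2 * m + 3) + 4) : ℝ≥0∞) := by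
    rw [ENNReal.ofNNReal_toNNReal]
    have : 0 ≤ (2 : ℝ) ^ (m + 1) * (2 * m + 3) := by positivity
    exact ENNReal.one_le_ofReal.2 (by linarith)
  rcases eq_or_ne x 0 with rfl | hx
  · have h0 : oddKernel m j (0 : RN N) = 0 := by simp [oddKernel]
    rw [h0, mul_zero, sub_zero]
    by_cases hy : y = 0
    · simp [hy, h0]
    · have : ¬ 2 * ‖y‖ ≤ ‖(0 : RN N)‖ := by simpa using hy
      rw [twoRegionKernel, if_neg this]
      exact (enorm_oddKernel_le m j _).trans (le_mul_of_one_le_left zero_le hA1)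
  have hx' := norm_pos_iff.2 hx
  by_cases hxy : 2 * ‖y‖ ≤ ‖x‖
  · rw [twoRegionKernel_of_le hx hxy, ENNReal.ofNNReal_toNNReal,
      ← ENNReal.ofReal_mul (by positivity), ← ofReal_norm]
    refine ENNReal.ofReal_le_ofReal ?_
    have e : oddKernel m j (x - y) - radialCutoff (‖x‖ / 2) y * oddKernel m j x
        = (oddKernel m j (x - y) - oddKernel m j x)
          + (1 - radialCutoff (‖x‖ / 2) y) * oddKernel m j x := by ring
    have hφ := abs_one_sub_radialCutoff_le (half_pos hx') (y := y) (by linarith)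
    have hxm : ‖y‖ / (‖x‖ / 2) * ‖x‖ ^ (-m) = 2 * (‖y‖ * ‖x‖ ^ (-(m + 1))) := by
      rw [show -m = -(m + 1) + 1 by ring, Real.rpow_add_one hx'.ne']
      field_simp
    rw [e, add_mul]
    refine (norm_add_le _ _).trans (add_le_add (abs_oddKernel_sub_sub_le hm j hx hxy) ?_)
    rw [norm_mul]
    calc _ ≤ 2 * (‖y‖ / (‖x‖ / 2)) * ‖x‖ ^ (-m) := by
          gcongr
          · exact hφ
          · exact abs_oddKernel_le m j x
      _ = _ := by rw [mul_assoc, hxm]; ring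
  · rw [twoRegionKernel, if_neg hxy, radialCutoff_eq_zero (half_pos hx') (by linarith), zero_mul,
      sub_zero]
    exact (enorm_oddKernel_le m j _).trans (le_mul_of_one_le_left zero_le hA1)

/-- Absorbs the subtracted term: K_j(x) times the cancellation weight |y|/(|x|/2) is at most twice
the first branch of the two-region kernel. -/
theorem enorm_oddKernel_mul_setLIntegral_le {m : ℝ} (j : Fin N) {x : RN N} (hx : x ≠ 0)
    (G : RN N → ℝ≥0∞) :
    ‖oddKernel m j x‖ₑ *
        ∫⁻ y in {y : RN N | ‖y‖ ≤ ‖x‖ / 2}, ENNReal.ofReal (‖y‖ / (‖x‖ / 2)) * G y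
      ≤ 2 * ∫⁻ y, twoRegionKernel m x y * G y := by
  have hx' := norm_pos_iff.2 hx
  have e2 : ∀ r : ℝ, ENNReal.ofReal (2 * r) = 2 * ENNReal.ofReal r := fun r => by
    rw [ENNReal.ofReal_mul (by norm_num)]; simp
  have hS : MeasurableSet {y : RN N | ‖y‖ ≤ ‖x‖ / 2} :=
    (isClosed_le (by fun_prop) (by fun_prop)).measurableSet
  rw [← lintegral_indicator hS, ← lintegral_const_mul' _ _ enorm_ne_top,
    ← lintegral_const_mul' _ _ (by simp)]
  refine lintegral_mono fun y => ?_
  by_cases hy : y ∈ {y : RN N | ‖y‖ ≤ ‖x‖ / 2}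
  · have hy' : 2 * ‖y‖ ≤ ‖x‖ := by
      have : ‖y‖ ≤ ‖x‖ / 2 := hy
      linarith
    rw [Set.indicator_of_mem hy, twoRegionKernel_of_le hx hy', ← mul_assoc, ← mul_assoc]
    gcongr ?_ * _
    rw [← ofReal_norm, ← ENNReal.ofReal_mul (by positivity),
      ← e2 (‖y‖ * ‖x‖ ^ (-(m + 1)))]
    refine ENNReal.ofReal_le_ofReal ?_
    calc _ ≤ ‖x‖ ^ (-m) * (‖y‖ / (‖x‖ / 2)) := by
          gcongr; exact abs_oddKernel_le m j x
      _ = _ := by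
          rw [show -m = -(m + 1) + 1 by ring, Real.rpow_add_one hx'.ne']
          field_simp
  · rw [Set.indicator_of_notMem hy]; simp

theorem exists_enorm_kernel_conv_le (hN : 2 ≤ N) {m : ℝ} (hm : 0 < m) (hmN : m < N) :
    ∃ A : ℝ≥0, ∀ {u : RN N → 𝕜}, LipCompact u → ∀ (j : Fin N) (x : RN N),
      ‖∫ y, oddKernel m j (x - y) • rieszTransform j u y‖ₑ
        ≤ A * ∫⁻ y, twoRegionKernel m x y * ‖rieszVector u y‖ₑ := by
  have hN1 : 1 ≤ N := by omega
  obtain ⟨A, hA⟩ := exists_enorm_oddKernel_sub_cutoff_le (N := N) hm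
  obtain ⟨C, hC⟩ := exists_enorm_integral_radialCutoff_le (N := N) (𝕜 := 𝕜) hN
  refine ⟨A + C * 2, fun {u} h j x => ?_⟩
  have hF : ∀ y, ‖rieszTransform j u y‖ₑ ≤ ‖rieszVector u y‖ₑ := fun y => by
    rw [← ofReal_norm, ← ofReal_norm]
    exact ENNReal.ofReal_le_ofReal (norm_rieszTransform_le u j y)
  have hmain : ‖∫ y, (oddKernel m j (x - y) - radialCutoff (‖x‖ / 2) y * oddKernel m j x) •
      rieszTransform j u y‖ₑ ≤ A * ∫⁻ y, twoRegionKernel m x y * ‖rieszVector u y‖ₑ := by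
    refine (enorm_integral_le_lintegral_enorm _).trans ?_
    rw [← lintegral_const_mul' _ _ ENNReal.coe_ne_top]
    refine lintegral_mono fun y => ?_
    rw [enorm_smul, ← mul_assoc]
    exact mul_le_mul' (hA j x y) (hF y)
  -- At x = 0 the cutoff radius degenerates, but K_j(0) = 0, so nothing is subtracted.
  rcases eq_or_ne x 0 with rfl | hx
  · have h0 : oddKernel m j (0 : RN N) = 0 := by simp [oddKernel]
    simp only [h0, mul_zero, sub_zero] at hmain
    refine hmain.trans ?_
    gcongr
    simp
  have hx' := norm_pos_iff.2 hx
  have i1 : Integrable fun y => oddKernel m j (x - y) • rieszTransform j u y := by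
    have := (h.integrable_kernel_smul_rieszTransform hN1 hm hmN j x).comp_sub_left x
    simpa [oddKernel] using this
  have i2 : Integrable fun y => radialCutoff (‖x‖ / 2) y • rieszTransform j u y := by
    obtain ⟨C₀, hC₀, hR⟩ := h.exists_rieszTransform_le hN1
    refine ((continuous_radialCutoff _).integrable_of_hasCompactSupport
      (hasCompactSupport_radialCutoff (half_pos hx'))).smul_bdd C₀
      (h.stronglyMeasurable_rieszTransform hN1 j).aestronglyMeasurable (ae_of_all _ fun y => ?_)
    refine (hR j y).trans (mul_le_of_le_one_right hC₀ ?_)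
    exact Real.rpow_le_one_of_one_le_of_nonpos (by linarith [norm_nonneg y]) (by simp)
  have e : ∫ y, oddKernel m j (x - y) • rieszTransform j u y =
      (∫ y, (oddKernel m j (x - y) - radialCutoff (‖x‖ / 2) y * oddKernel m j x) •
        rieszTransform j u y)
      + oddKernel m j x • ∫ y, radialCutoff (‖x‖ / 2) y • rieszTransform j u y := by
    rw [← integral_smul, ← integral_add]
    · congr 1 with y
      rw [sub_smul, mul_comm (radialCutoff _ y), mul_smul, sub_add_cancel]
    · refine (i1.sub (i2.smul (oddKernel m j x))).congr (ae_of_all _ fun y => ?_)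
      simp only [Pi.sub_apply, Pi.smul_apply]
      rw [sub_smul, mul_comm (radialCutoff _ y), mul_smul]
    · exact i2.smul (oddKernel m j x)
  rw [e, ENNReal.coe_add, add_mul]
  refine (enorm_add_le _ _).trans (add_le_add hmain ?_)
  rw [enorm_smul]
  calc _ ≤ ‖oddKernel m j x‖ₑ * (C * ∫⁻ y in {y : RN N | ‖y‖ ≤ ‖x‖ / 2},
        ENNReal.ofReal (‖y‖ / (‖x‖ / 2)) * ‖rieszVector u y‖ₑ) := by
        gcongr; exact hC h j (half_pos hx')
    _ = C * (‖oddKernel m j x‖ₑ * ∫⁻ y in {y : RN N | ‖y‖ ≤ ‖x‖ / 2},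
        ENNReal.ofReal (‖y‖ / (‖x‖ / 2)) * ‖rieszVector u y‖ₑ) := by ring
    _ ≤ C * (2 * ∫⁻ y, twoRegionKernel m x y * ‖rieszVector u y‖ₑ) := by
        exact mul_le_mul_right (enorm_oddKernel_mul_setLIntegral_le j hx _) _
    _ = _ := by push_cast; ring

theorem exists_enorm_rieszPotential_le (hN : 2 ≤ N) {l : ℝ} (hl0 : 0 < l) (hlN : l < N) :
    ∃ A : ℝ≥0, ∀ {u : RN N → 𝕜}, LipCompact u → ∀ x : RN N,
      ‖rieszPotential l u x‖ₑ
        ≤ A * ∫⁻ y, twoRegionKernel (N - l) x y * ‖rieszVector u y‖ₑ := by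
  have hm : 0 < (N : ℝ) - l := by linarith
  have hmN : (N : ℝ) - l < N := by linarith
  obtain ⟨A, hA⟩ := exists_enorm_kernel_conv_le (𝕜 := 𝕜) hN hm hmN
  obtain ⟨c, hc, hsum⟩ := exists_sum_kernel_rieszTransform_eq (𝕜 := 𝕜) (N := N) (by omega) hm hmN
  refine ⟨‖1 / rieszGamma N l‖₊ * (‖c⁻¹‖₊ * (N * A)), fun {u} h x => ?_⟩
  have e : rieszPotential l u x = (1 / rieszGamma N l) • (c⁻¹ •
      ∑ j, ∫ y, oddKernel (N - l) j (x - y) • rieszTransform j u y) := by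
    rw [rieszPotential]
    congr 1
    rw [eq_inv_smul_iff₀ hc]
    rw [← integral_sub_left_eq_self _ volume x]
    have h1 := hsum h x
    have h2 : ∫ z : RN N, (1 / ‖x - (x - z)‖ ^ ((N : ℝ) - l)) • u (x - z)
        = ∫ z : RN N, ‖z‖ ^ (-((N : ℝ) - l)) • u (x - z) := by
      congr 1 with z
      rw [sub_sub_cancel, Real.rpow_neg (norm_nonneg z), one_div]
    rw [h2, ← h1]
    refine Finset.sum_congr rfl fun j _ => ?_
    rw [← integral_sub_left_eq_self _ volume x]
    simp only [oddKernel, sub_sub_cancel]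
  rw [e, enorm_smul, enorm_smul]
  push_cast
  rw [mul_assoc, mul_assoc, mul_assoc]
  gcongr ?_ * (?_ * ?_)
  · exact le_rfl
  · exact le_rfl
  · refine (enorm_sum_le _ _).trans ?_
    refine (Finset.sum_le_sum fun j _ => hA h j x).trans_eq ?_
    simp

end Pointwise

/-! ### The L^q(ν) norm of the two-region kernel -/

section KernelBound

variable {N : ℕ} {𝕜 : Type*} [RCLike 𝕜]

theorem measurable_twoRegionKernel (m : ℝ) :
    Measurable fun p : RN N × RN N => twoRegionKernel m p.1 p.2 := by
  unfold twoRegionKernel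
  refine Measurable.ite ?_ (by fun_prop) (by fun_prop)
  exact (isClosed_le (by fun_prop) (by fun_prop)).measurableSet

theorem LipCompact.measurable_rieszVector (hN : 1 ≤ N) {u : RN N → 𝕜} (h : LipCompact u) :
    Measurable (rieszVector u) :=
  (PiLp.continuous_toLp 2 _).measurable.comp
    (measurable_pi_lambda _ fun j => (h.stronglyMeasurable_rieszTransform hN j).measurable)

/-- The branches of the kernel are separated by the sphere |x| = 2|y|, and r ↦ r^{1/q} is
subadditive since q ≥ 1. The inner branch lives on the ball of radius 2|y|, which is enlarged to
4|y| to match the testing condition. -/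
theorem lintegral_twoRegionKernel_rpow_le {m q : ℝ} (hq : 1 ≤ q) (ν : Measure (RN N)) (y : RN N) :
    (∫⁻ x, twoRegionKernel m x y ^ q ∂ν) ^ (1 / q) ≤
      ‖y‖ₑ * (∫⁻ x in (Metric.ball (0 : RN N) (2 * ‖y‖))ᶜ, 1 / ‖x‖ₑ ^ ((m + 1) * q) ∂ν) ^ (1 / q)
      + (∫⁻ x in Metric.ball (0 : RN N) (4 * ‖y‖), 1 / ‖x - y‖ₑ ^ (m * q) ∂ν) ^ (1 / q) := by
  have hq0 : 0 < q := by linarith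
  have hS : MeasurableSet (Metric.ball (0 : RN N) (2 * ‖y‖)) := measurableSet_ball
  have e1 : ∀ x ∈ (Metric.ball (0 : RN N) (2 * ‖y‖))ᶜ,
      twoRegionKernel m x y ^ q = ‖y‖ₑ ^ q * (1 / ‖x‖ₑ ^ ((m + 1) * q)) := fun x hx => by
    have : 2 * ‖y‖ ≤ ‖x‖ := by simpa using hx
    rw [twoRegionKernel, if_pos this, ENNReal.mul_rpow_of_nonneg _ _ hq0.le,
      ENNReal.div_rpow_of_nonneg _ _ hq0.le, ENNReal.one_rpow, ← ENNReal.rpow_mul]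
  have e2 : ∀ x ∈ Metric.ball (0 : RN N) (2 * ‖y‖),
      twoRegionKernel m x y ^ q = 1 / ‖x - y‖ₑ ^ (m * q) := fun x hx => by
    have : ¬ 2 * ‖y‖ ≤ ‖x‖ := by simpa using hx
    rw [twoRegionKernel, if_neg this,
      ENNReal.div_rpow_of_nonneg _ _ hq0.le, ENNReal.one_rpow, ← ENNReal.rpow_mul]
  rw [← lintegral_add_compl _ hS, setLIntegral_congr_fun hS e2, setLIntegral_congr_fun hS.compl e1,
    lintegral_const_mul' _ _ (ENNReal.rpow_ne_top_of_nonneg hq0.le enorm_ne_top), add_comm]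
  refine (ENNReal.rpow_add_le_add_rpow _ _ (by positivity) ((div_le_one hq0).2 hq)).trans ?_
  refine add_le_add ?_ ?_
  · rw [ENNReal.mul_rpow_of_nonneg _ _ (by positivity), ← ENNReal.rpow_mul,
      mul_one_div_cancel hq0.ne', ENNReal.rpow_one]
  · refine ENNReal.rpow_le_rpow (lintegral_mono_set (Metric.ball_subset_ball ?_)) (by positivity)
    linarith [norm_nonneg y]

end KernelBound

/-! ### The weighted inequality -/

theorem theorem6p3 {𝕜 : Type*} [RCLike 𝕜] (N : ℕ) (hN : 2 ≤ N) (l : ℝ) (hl0 : 0 < l)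
    (hlN : l < (N : ℝ)) (q : ℝ) (hq : 1 ≤ q) (ν : Measure (RN N)) [SigmaFinite ν]
    (w : RN N → ℝ) (hw : IsWeight w)
    (hout : OuterTesting l q ν w) (hin : InnerTesting l q ν w) :
    ∃ C : ℝ≥0, 0 < C ∧ ∀ u : RN N → 𝕜, ContDiff ℝ ∞ u → HasCompactSupport u →
      (∫⁻ x, ‖rieszPotential l u x‖ₑ ^ q ∂ν) ^ (1 / q)
        ≤ (C : ℝ≥0∞) * weightedL1Norm w (rieszVector u) := by
  have hq0 : 0 < q := by linarith
  have : Nonempty (Fin N) := ⟨⟨0, by omega⟩⟩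
  obtain ⟨A, hA⟩ := exists_enorm_rieszPotential_le (𝕜 := 𝕜) hN hl0 hlN
  obtain ⟨C₃, hC₃, hout⟩ := hout
  obtain ⟨C₄, hC₄, hin⟩ := hin
  -- A + 1 instead of A keeps the constant positive even if A = 0.
  refine ⟨(A + 1) * Real.toNNReal (C₃ + C₄),
    mul_pos (by positivity) (Real.toNNReal_pos.2 (by linarith)), fun u hu huc => ?_⟩
  have h : LipCompact u := LipCompact.of_contDiff hu huc
  have hG : Measurable fun y => ‖rieszVector u y‖ₑ := (h.measurable_rieszVector (by omega)).enorm
  have hk := measurable_twoRegionKernel (N := N) (N - l)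
  have hkG : Measurable (Function.uncurry fun x y : RN N =>
      twoRegionKernel (N - l) x y * ‖rieszVector u y‖ₑ) := hk.mul (hG.comp measurable_snd)
  calc (∫⁻ x, ‖rieszPotential l u x‖ₑ ^ q ∂ν) ^ (1 / q)
      ≤ (∫⁻ x, (A * ∫⁻ y, twoRegionKernel (N - l) x y * ‖rieszVector u y‖ₑ) ^ q ∂ν) ^ (1 / q) := by
        gcongr with x
        exact hA h x
    _ = A * (∫⁻ x, (∫⁻ y, twoRegionKernel (N - l) x y * ‖rieszVector u y‖ₑ) ^ q ∂ν) ^ (1 / q) := by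
        simp_rw [ENNReal.mul_rpow_of_nonneg _ _ hq0.le]
        rw [lintegral_const_mul' _ _ (ENNReal.rpow_ne_top_of_nonneg hq0.le ENNReal.coe_ne_top),
          ENNReal.mul_rpow_of_nonneg _ _ (by positivity), ← ENNReal.rpow_mul,
          mul_one_div_cancel hq0.ne', ENNReal.rpow_one]
    _ ≤ A * ∫⁻ y, (∫⁻ x, (twoRegionKernel (N - l) x y * ‖rieszVector u y‖ₑ) ^ q ∂ν) ^ (1 / q) := by
        gcongr
        exact lintegral_rpow_lintegral_le hkG hq
    _ ≤ A * ∫⁻ y, ENNReal.ofReal (C₃ + C₄) * (‖rieszVector u y‖ₑ * ENNReal.ofReal (w y)) := by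
        gcongr A * ?_
        refine lintegral_mono_ae ?_
        -- Excluding y = 0 allows |y| · (w(y)/|y|) = w(y); positivity of w lets `ENNReal.ofReal`
        -- split over the sum.
        filter_upwards [hout, hin, Measure.ae_ne volume (0 : RN N), hw.2] with y hy3 hy4 hy0 hwy
        have hy0' := norm_pos_iff.2 hy0
        simp_rw [ENNReal.mul_rpow_of_nonneg _ _ hq0.le]
        rw [lintegral_mul_const' _ _ (ENNReal.rpow_ne_top_of_nonneg hq0.le enorm_ne_top),
          ENNReal.mul_rpow_of_nonneg _ _ (by positivity), ← ENNReal.rpow_mul (‖rieszVector u y‖ₑ),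
          mul_one_div_cancel hq0.ne', ENNReal.rpow_one, mul_left_comm, mul_comm]
        gcongr
        refine (lintegral_twoRegionKernel_rpow_le hq ν y).trans ?_
        rw [← ENNReal.ofReal_mul (by positivity), add_mul C₃,
          ENNReal.ofReal_add (by positivity) (by positivity)]
        refine add_le_add ?_ hy4
        refine (mul_le_mul_right hy3 _).trans_eq ?_
        rw [← ofReal_norm, ← ENNReal.ofReal_mul (norm_nonneg y)]
        congr 1
        field_simp
    _ = A * ENNReal.ofReal (C₃ + C₄) * weightedL1Norm w (rieszVector u) := by
        rw [lintegral_const_mul' _ _ ENNReal.ofReal_ne_top, weightedL1Norm, mul_assoc]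
    _ ≤ _ := by
        push_cast
        rw [ENNReal.ofNNReal_toNNReal]
        gcongr
        exact le_self_add
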